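/- Let $G$ be a second countable locally compact (Hausdorff) group with a right Haar measure $\lambda$, and let $\Phi$ be a Young function, that is, a continuous, even and convex function $\Phi:\mathbb R\to\mathbb R$ with $\Phi(0)=0$, $\Phi(t)>0$ for $t>0$ and $\lim_{t\to\infty}\Phi(t)=\infty$. Assume that $\Phi$ is $\Delta_2$-regular: there are constants $M>0$ and $t_0>0$ with $\Phi(2t)\le M\Phi(t)$ for all $t\ge t_0$ if $G$ is compact, and for all $t>0$ if $G$ is noncompact. Let $$L^\Phi(G)=\Big\{f:G\to\mathbb C \text{ Borel measurable}: \int_G\Phi(\alpha|f|)\,d\lambda<\infty\text{ for some }\alpha>0\Big\}$$ (functions equal $\lambda$-almost everywhere being identified) carry the Luxemburg norm $N_\Phi(f)=\inf\{k>0:\int_G\Phi(|f|/k)\,d\lambda\le 1\}$. Let $w:G\to(0,\infty)$ be a bounded continuous function with $w^{-1}\in L^\infty(G)$, and let $a\in G$ be aperiodic, i.e. the closed subgroup generated by $a$ is not compact. Let $T_{a,w}$ be the weighted translation on $L^\Phi(G)$ given by $(T_{a,w}f)(x)=w(x)f(xa^{-1})$. For $n\ge0$ put $$\varphi_n(x)=\prod_{j=1}^{n}w(xa^{j}),\qquad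 \widetilde\varphi_n(x)=\Big(\prod_{j=0}^{n-1}w(xa^{-j})\Big)^{-1}\qquad(x\in G).$$ Then the following conditions are equivalent. (i) $T_{a,w}$ is topologically transitive: for all nonempty open sets $U,V\subset L^\Phi(G)$ there is $n\in\mathbb N$ with $T_{a,w}^nU\cap V\ne\emptyset$. (ii) $T_{a,w}$ is hypercyclic: there is $f\in L^\Phi(G)$ whose orbit $\{T_{a,w}^nf:n\in\mathbb N\}$ is dense in $L^\Phi(G)$. (iii) For each compact subset $K\subset G$ with $\lambda(K)>0$ there are a sequence of Borel sets $E_k\subset K$ with $\lim_{k\to\infty}\lambda(E_k)=\lambda(K)$ and a strictly increasing sequence $(n_k)$ of natural numbers such that $$\lim_{k\to\infty}\big\|\varphi_{n_k}|_{E_k}\big\|_\infty=\lim_{k\to\infty}\big\|\widetilde\varphi_{n_k}|_{E_k}\big\|_\infty=0 .$$ Here $\mathbb N$ includes $0$, and $\|\cdot\|_\infty$ is the essential supremum norm with respect to $\lambda$. -/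

import Mathlib

open MeasureTheory Filter Topology
open scoped ENNReal

noncomputable section

/-- A Young function: a continuous, even and convex function `Φ : ℝ → ℝ` with `Φ 0 = 0`,
`Φ t > 0` for `t > 0`, and `Φ t → ∞` as `t → ∞`. -/
structure YoungFunction where
  toFun : ℝ → ℝ
  continuous' : Continuous toFun
  even' : ∀ t, toFun (-t) = toFun t
  convex' : ConvexOn ℝ Set.univ toFun
  zero' : toFun 0 = 0
  pos' : ∀ t, 0 < t → 0 < toFun t
  tendsto' : Tendsto toFun atTop atTop

namespace YoungFunction

instance : CoeFun YoungFunction (fun _ => ℝ → ℝ) := ⟨YoungFunction.toFun⟩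

/-- `Δ₂`-regularity with respect to a space `G`: the doubling condition is required for all large
`t` when `G` is compact, and for all `t > 0` when `G` is noncompact. -/
def IsDelta2Regular (Φ : YoungFunction) (G : Type*) [TopologicalSpace G] : Prop :=
  (CompactSpace G → ∃ M > 0, ∃ t₀ > 0, ∀ t ≥ t₀, Φ (2 * t) ≤ M * Φ t) ∧
  (NoncompactSpace G → ∃ M > 0, ∀ t > 0, Φ (2 * t) ≤ M * Φ t)

variable (Φ : YoungFunction)

theorem nonneg {t : ℝ} (ht : 0 ≤ t) : 0 ≤ Φ t := by
  rcases ht.eq_or_lt with rfl | h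
  · exact Φ.zero'.ge
  · exact (Φ.pos' t h).le

theorem comb_le {a b s t : ℝ} (ha : 0 ≤ a) (hb : 0 ≤ b) (hab : a + b = 1) :
    Φ (a * s + b * t) ≤ a * Φ s + b * Φ t := by
  simpa using Φ.convex'.2 (Set.mem_univ s) (Set.mem_univ t) ha hb hab

theorem scale_le {a t : ℝ} (ha : 0 ≤ a) (ha1 : a ≤ 1) : Φ (a * t) ≤ a * Φ t := by
  have := Φ.comb_le (s := t) (t := 0) ha (sub_nonneg.2 ha1) (by ring)
  simpa [Φ.zero'] using this

theorem mono {s t : ℝ} (hs : 0 ≤ s) (hst : s ≤ t) : Φ s ≤ Φ t := by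
  rcases (hs.trans hst).eq_or_lt with h | h
  · have : s = t := le_antisymm hst (by linarith)
    rw [this]
  · have h1 : s / t ≤ 1 := (div_le_one h).2 hst
    have h2 := Φ.scale_le (t := t) (div_nonneg hs h.le) h1
    rw [div_mul_cancel₀ _ h.ne'] at h2
    exact h2.trans (mul_le_of_le_one_left (Φ.nonneg h.le) h1)

end YoungFunction

section Orlicz

variable {α : Type*} [MeasurableSpace α]

/-- The modular `∫ Φ(|f| c) dμ`, with values in `[0, ∞]`. -/
def orliczModular (Φ : YoungFunction) (μ : Measure α) (c : ℝ) (f : α → ℂ) : ℝ≥0∞ :=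
  ∫⁻ x, ENNReal.ofReal (Φ (c * ‖f x‖)) ∂μ

/-- The Luxemburg norm `inf {k > 0 : ∫ Φ(|f| / k) dμ ≤ 1}`. -/
def luxemburgNorm (Φ : YoungFunction) (μ : Measure α) (f : α → ℂ) : ℝ :=
  sInf {k : ℝ | 0 < k ∧ orliczModular Φ μ k⁻¹ f ≤ 1}

variable {Φ : YoungFunction} {μ : Measure α}

theorem orliczModular_mono {c d : ℝ} {f g : α → ℂ} (hc : 0 ≤ c)
    (h : ∀ᵐ x ∂μ, c * ‖f x‖ ≤ d * ‖g x‖) : orliczModular Φ μ c f ≤ orliczModular Φ μ d g := by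
  apply lintegral_mono_ae
  filter_upwards [h] with x hx
  exact ENNReal.ofReal_le_ofReal (Φ.mono (by positivity) hx)

theorem orliczModular_scale {a c : ℝ} {f : α → ℂ} (ha : 0 ≤ a) (ha1 : a ≤ 1) :
    orliczModular Φ μ (a * c) f ≤ ENNReal.ofReal a * orliczModular Φ μ c f := by
  unfold orliczModular
  rw [← lintegral_const_mul' _ _ ENNReal.ofReal_ne_top]
  apply lintegral_mono
  intro x
  dsimp only
  rw [← ENNReal.ofReal_mul ha, mul_assoc]
  exact ENNReal.ofReal_le_ofReal (Φ.scale_le ha ha1)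

theorem aemeasurable_modular (c : ℝ) {f : α → ℂ} (hf : AEStronglyMeasurable f μ) :
    AEMeasurable (fun x => ENNReal.ofReal (Φ (c * ‖f x‖))) μ :=
  (Φ.continuous'.measurable.comp_aemeasurable
    ((hf.norm.aemeasurable).const_mul c)).ennreal_ofReal

theorem orliczModular_comb {a b c d e : ℝ} {f g h : α → ℂ} (ha : 0 ≤ a) (hb : 0 ≤ b)
    (hab : a + b = 1) (he : 0 ≤ e) (hc : 0 ≤ c) (hd : 0 ≤ d) (hf : AEStronglyMeasurable f μ)
    (hle : ∀ᵐ x ∂μ, e * ‖h x‖ ≤ a * (c * ‖f x‖) + b * (d * ‖g x‖)) :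
    orliczModular Φ μ e h ≤
      ENNReal.ofReal a * orliczModular Φ μ c f + ENNReal.ofReal b * orliczModular Φ μ d g := by
  unfold orliczModular
  rw [← lintegral_const_mul' _ _ ENNReal.ofReal_ne_top,
    ← lintegral_const_mul' _ _ ENNReal.ofReal_ne_top,
    ← lintegral_add_left' ((aemeasurable_modular c hf).const_mul _)]
  apply lintegral_mono_ae
  filter_upwards [hle] with x hx
  rw [← ENNReal.ofReal_mul ha, ← ENNReal.ofReal_mul hb,
    ← ENNReal.ofReal_add (mul_nonneg ha (Φ.nonneg (by positivity)))
      (mul_nonneg hb (Φ.nonneg (by positivity)))]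
  exact ENNReal.ofReal_le_ofReal ((Φ.mono (by positivity) hx).trans (Φ.comb_le ha hb hab))

theorem luxemburgNorm_bddBelow (f : α → ℂ) :
    BddBelow {k : ℝ | 0 < k ∧ orliczModular Φ μ k⁻¹ f ≤ 1} := ⟨0, fun _ hk => hk.1.le⟩

theorem luxemburgNorm_le {k : ℝ} {f : α → ℂ} (hk : 0 < k) (h : orliczModular Φ μ k⁻¹ f ≤ 1) :
    luxemburgNorm Φ μ f ≤ k := csInf_le (luxemburgNorm_bddBelow f) ⟨hk, h⟩

theorem luxemburgNorm_nonneg (f : α → ℂ) : 0 ≤ luxemburgNorm Φ μ f :=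
  Real.sInf_nonneg fun _ hk => hk.1.le

variable (Φ μ) in
/-- The Orlicz space `L^Φ(μ)`: the (classes modulo almost everywhere equality of) measurable
functions `f : α → ℂ` such that `∫ Φ(c |f|) dμ < ∞` for some `c > 0`. -/
def OrliczSpace : AddSubgroup (α →ₘ[μ] ℂ) where
  carrier := {f | ∃ c > 0, orliczModular Φ μ c f < ∞}
  zero_mem' := by
    refine ⟨1, one_pos, ?_⟩
    have : orliczModular Φ μ 1 (0 : α →ₘ[μ] ℂ) = ∫⁻ _, 0 ∂μ := by
      apply lintegral_congr_ae
      filter_upwards [AEEqFun.coeFn_zero (μ := μ) (β := ℂ)] with x hx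
      simp [hx, Φ.zero']
    rw [this]; simp
  add_mem' := by
    rintro f g ⟨c, hc, hf⟩ ⟨d, hd, hg⟩
    refine ⟨min c d / 2, by positivity, ?_⟩
    refine (orliczModular_comb (a := 1 / 2) (b := 1 / 2) (c := c) (d := d) (f := f) (g := g)
      (by norm_num) (by norm_num) (by norm_num) (by positivity) hc.le hd.le
      f.aestronglyMeasurable ?_).trans_lt ?_
    · filter_upwards [AEEqFun.coeFn_add f g] with x hx
      rw [hx, Pi.add_apply]
      have h1 := norm_add_le (f x) (g x)
      have h2 := mul_le_mul_of_nonneg_right (min_le_left c d) (norm_nonneg (f x))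
      have h3 := mul_le_mul_of_nonneg_right (min_le_right c d) (norm_nonneg (g x))
      have h4 := mul_le_mul_of_nonneg_left h1 (le_min hc.le hd.le)
      linarith
    · exact ENNReal.add_lt_top.2 ⟨ENNReal.mul_lt_top ENNReal.ofReal_lt_top hf,
        ENNReal.mul_lt_top ENNReal.ofReal_lt_top hg⟩
  neg_mem' := by
    rintro f ⟨c, hc, hf⟩
    refine ⟨c, hc, (orliczModular_mono hc.le ?_).trans_lt hf⟩
    filter_upwards [AEEqFun.coeFn_neg f] with x hx
    rw [hx, Pi.neg_apply, norm_neg]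

namespace OrliczSpace

instance : AddCommGroup (OrliczSpace Φ μ) := AddSubgroup.toAddCommGroup _

theorem smul_mem (z : ℂ) {f : α →ₘ[μ] ℂ} (hf : f ∈ OrliczSpace Φ μ) :
    z • f ∈ OrliczSpace Φ μ := by
  obtain ⟨c, hc, hf⟩ := hf
  refine ⟨c / (‖z‖ + 1), by positivity, (orliczModular_mono (by positivity) ?_).trans_lt hf⟩
  filter_upwards [AEEqFun.coeFn_smul z f] with x hx
  rw [hx, Pi.smul_apply, norm_smul, div_mul_eq_mul_div, div_le_iff₀ (by positivity)]
  nlinarith [norm_nonneg z, norm_nonneg (f x), mul_nonneg hc.le (norm_nonneg (f x))]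

instance : SMul ℂ (OrliczSpace Φ μ) := ⟨fun z f => ⟨z • (f : α →ₘ[μ] ℂ), smul_mem z f.2⟩⟩

theorem coe_smul (z : ℂ) (f : OrliczSpace Φ μ) :
    ((z • f : OrliczSpace Φ μ) : α →ₘ[μ] ℂ) = z • (f : α →ₘ[μ] ℂ) := rfl

instance : Module ℂ (OrliczSpace Φ μ) where
  one_smul f := Subtype.ext (one_smul ℂ (f : α →ₘ[μ] ℂ))
  mul_smul y z f := Subtype.ext (mul_smul y z (f : α →ₘ[μ] ℂ))
  smul_zero z := Subtype.ext (smul_zero (A := α →ₘ[μ] ℂ) z)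
  smul_add z f g := Subtype.ext (smul_add z (f : α →ₘ[μ] ℂ) (g : α →ₘ[μ] ℂ))
  add_smul y z f := Subtype.ext (add_smul y z (f : α →ₘ[μ] ℂ))
  zero_smul f := Subtype.ext (zero_smul ℂ (f : α →ₘ[μ] ℂ))

theorem exists_modular_le_one (f : OrliczSpace Φ μ) :
    {k : ℝ | 0 < k ∧ orliczModular Φ μ k⁻¹ (f : α →ₘ[μ] ℂ) ≤ 1}.Nonempty := by
  obtain ⟨f, c, hc, hf⟩ := f
  set C := (orliczModular Φ μ c f).toReal with hC
  have hC0 : 0 ≤ C := ENNReal.toReal_nonneg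
  have ha0 : 0 ≤ 1 / (1 + C) := by positivity
  have ha1 : 1 / (1 + C) ≤ 1 := by rw [div_le_one (by positivity)]; linarith
  refine ⟨((1 / (1 + C)) * c)⁻¹, by positivity, ?_⟩
  rw [inv_inv]
  refine (orliczModular_scale ha0 ha1).trans ?_
  rw [← ENNReal.ofReal_toReal hf.ne, ← ENNReal.ofReal_mul ha0, ← hC]
  refine ENNReal.ofReal_le_one.2 ?_
  rw [div_mul_eq_mul_div, one_mul, div_le_one (by positivity)]
  linarith

theorem luxemburgNorm_le_mul {C : ℝ} (hC : 0 < C) (f : OrliczSpace Φ μ) (g : α → ℂ)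
    (h : ∀ k > 0, orliczModular Φ μ (C * k)⁻¹ g ≤ orliczModular Φ μ k⁻¹ (f : α →ₘ[μ] ℂ)) :
    luxemburgNorm Φ μ g ≤ C * luxemburgNorm Φ μ (f : α →ₘ[μ] ℂ) := by
  rw [← div_le_iff₀' hC]
  refine le_csInf (exists_modular_le_one f) ?_
  rintro k ⟨hk, hk1⟩
  rw [div_le_iff₀' hC]
  exact luxemburgNorm_le (by positivity) ((h k hk).trans hk1)

theorem luxemburgNorm_zero : luxemburgNorm Φ μ ((0 : α →ₘ[μ] ℂ) : α → ℂ) = 0 := by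
  refine le_antisymm (le_of_forall_pos_le_add fun ε hε => ?_) (luxemburgNorm_nonneg _)
  rw [zero_add]
  refine luxemburgNorm_le hε ?_
  have : orliczModular Φ μ ε⁻¹ (0 : α →ₘ[μ] ℂ) = ∫⁻ _, 0 ∂μ := by
    apply lintegral_congr_ae
    filter_upwards [AEEqFun.coeFn_zero (μ := μ) (β := ℂ)] with x hx
    simp [hx, Φ.zero']
  rw [this]; simp

theorem luxemburgNorm_add (f g : OrliczSpace Φ μ) :
    luxemburgNorm Φ μ ((f + g : OrliczSpace Φ μ) : α →ₘ[μ] ℂ) ≤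
      luxemburgNorm Φ μ (f : α →ₘ[μ] ℂ) + luxemburgNorm Φ μ (g : α →ₘ[μ] ℂ) := by
  have key : ∀ k ∈ {k : ℝ | 0 < k ∧ orliczModular Φ μ k⁻¹ (f : α →ₘ[μ] ℂ) ≤ 1},
      ∀ l ∈ {k : ℝ | 0 < k ∧ orliczModular Φ μ k⁻¹ (g : α →ₘ[μ] ℂ) ≤ 1},
      luxemburgNorm Φ μ ((f + g : OrliczSpace Φ μ) : α →ₘ[μ] ℂ) ≤ k + l := by
    rintro k ⟨hk, hk1⟩ l ⟨hl, hl1⟩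
    have hab : k / (k + l) + l / (k + l) = 1 := by field_simp
    refine luxemburgNorm_le (by positivity) ((orliczModular_comb (a := k / (k + l))
      (b := l / (k + l)) (c := k⁻¹) (d := l⁻¹) (f := (f : α →ₘ[μ] ℂ)) (g := (g : α →ₘ[μ] ℂ))
      (by positivity) (by positivity) hab (by positivity) (by positivity)
      (by positivity) (f : α →ₘ[μ] ℂ).aestronglyMeasurable ?_).trans ?_)
    · filter_upwards [AEEqFun.coeFn_add (f : α →ₘ[μ] ℂ) (g : α →ₘ[μ] ℂ)] with x hx
      rw [AddSubgroup.coe_add, hx, Pi.add_apply]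
      have h1 := norm_add_le ((f : α →ₘ[μ] ℂ) x) ((g : α →ₘ[μ] ℂ) x)
      calc _ ≤ (k + l)⁻¹ * (‖(f : α →ₘ[μ] ℂ) x‖ + ‖(g : α →ₘ[μ] ℂ) x‖) := by gcongr
        _ = _ := by field_simp
    · calc _ ≤ ENNReal.ofReal (k / (k + l)) * 1 + ENNReal.ofReal (l / (k + l)) * 1 := by gcongr
        _ = 1 := by
          rw [mul_one, mul_one, ← ENNReal.ofReal_add (by positivity) (by positivity), hab,
            ENNReal.ofReal_one]
  have h1 : ∀ k ∈ {k : ℝ | 0 < k ∧ orliczModular Φ μ k⁻¹ (f : α →ₘ[μ] ℂ) ≤ 1},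
      luxemburgNorm Φ μ ((f + g : OrliczSpace Φ μ) : α →ₘ[μ] ℂ) - k ≤
        luxemburgNorm Φ μ (g : α →ₘ[μ] ℂ) := fun k hk =>
    le_csInf (exists_modular_le_one g) fun l hl => by linarith [key k hk l hl]
  have h2 : luxemburgNorm Φ μ ((f + g : OrliczSpace Φ μ) : α →ₘ[μ] ℂ) -
      luxemburgNorm Φ μ (g : α →ₘ[μ] ℂ) ≤ luxemburgNorm Φ μ (f : α →ₘ[μ] ℂ) :=
    le_csInf (exists_modular_le_one f) fun k hk => by linarith [h1 k hk]
  linarith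

theorem luxemburgNorm_smul_le (z : ℂ) (f : OrliczSpace Φ μ) :
    luxemburgNorm Φ μ ((z • f : OrliczSpace Φ μ) : α →ₘ[μ] ℂ) ≤
      ‖z‖ * luxemburgNorm Φ μ (f : α →ₘ[μ] ℂ) := by
  rcases eq_or_ne z 0 with rfl | hz
  · rw [zero_smul, AddSubgroup.coe_zero, luxemburgNorm_zero]; simp
  · have hz' : 0 < ‖z‖ := norm_pos_iff.2 hz
    refine luxemburgNorm_le_mul hz' f _ fun k hk => orliczModular_mono (by positivity) ?_
    filter_upwards [AEEqFun.coeFn_smul z (f : α →ₘ[μ] ℂ)] with x hx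
    rw [coe_smul, hx, Pi.smul_apply, norm_smul]
    apply le_of_eq
    field_simp

theorem eq_zero_of_luxemburgNorm (f : OrliczSpace Φ μ)
    (hf : luxemburgNorm Φ μ (f : α →ₘ[μ] ℂ) = 0) : f = 0 := by
  have h1 : ∀ ε : ℝ, 0 < ε → ε ≤ 1 →
      orliczModular Φ μ 1 (f : α →ₘ[μ] ℂ) ≤ ENNReal.ofReal ε := by
    intro ε hε hε1
    have hlt : luxemburgNorm Φ μ (f : α →ₘ[μ] ℂ) < ε := hf ▸ hε
    obtain ⟨k, ⟨hk, hk1⟩, hkε⟩ := exists_lt_of_csInf_lt (exists_modular_le_one f) hlt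
    have h := orliczModular_scale (Φ := Φ) (μ := μ) (c := k⁻¹) (f := (f : α →ₘ[μ] ℂ)) hk.le
      (hkε.le.trans hε1)
    rw [mul_inv_cancel₀ hk.ne'] at h
    calc _ ≤ _ := h
      _ ≤ ENNReal.ofReal k * 1 := by gcongr
      _ ≤ ENNReal.ofReal ε := by rw [mul_one]; exact ENNReal.ofReal_le_ofReal hkε.le
  have h0 : orliczModular Φ μ 1 (f : α →ₘ[μ] ℂ) = 0 := by
    refine le_antisymm (ENNReal.le_of_forall_pos_le_add fun ε hε _ => ?_) zero_le
    rw [zero_add]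
    refine (h1 (min ε 1) (by positivity) (min_le_right _ _)).trans ?_
    rw [ENNReal.ofReal_le_iff_le_toReal ENNReal.coe_ne_top]
    simp
  have h2 := (lintegral_eq_zero_iff' (aemeasurable_modular (Φ := Φ) 1
    (f : α →ₘ[μ] ℂ).aestronglyMeasurable)).1 h0
  apply Subtype.ext
  apply AEEqFun.ext
  filter_upwards [h2, AEEqFun.coeFn_zero (μ := μ) (β := ℂ)] with x hx hx0
  rw [AddSubgroup.coe_zero, hx0]
  by_contra hne
  have hp := Φ.pos' (1 * ‖(f : α →ₘ[μ] ℂ) x‖) (by rw [one_mul]; exact norm_pos_iff.2 hne)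
  have hx' : ENNReal.ofReal (Φ (1 * ‖(f : α →ₘ[μ] ℂ) x‖)) = 0 := hx
  exact absurd (ENNReal.ofReal_eq_zero.1 hx') (not_le.2 hp)

theorem luxemburgNorm_neg (f : OrliczSpace Φ μ) :
    luxemburgNorm Φ μ ((-f : OrliczSpace Φ μ) : α →ₘ[μ] ℂ) =
      luxemburgNorm Φ μ (f : α →ₘ[μ] ℂ) := by
  have h : ∀ g : OrliczSpace Φ μ, luxemburgNorm Φ μ ((-g : OrliczSpace Φ μ) : α →ₘ[μ] ℂ) ≤
      luxemburgNorm Φ μ (g : α →ₘ[μ] ℂ) := fun g => by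
    have h := luxemburgNorm_smul_le (-1 : ℂ) g
    rwa [neg_one_smul, norm_neg, norm_one, one_mul] at h
  refine le_antisymm (h f) ?_
  have h' := h (-f)
  rwa [neg_neg] at h'

/-- `L^Φ(μ)` is normed by the Luxemburg norm. -/
instance : NormedAddCommGroup (OrliczSpace Φ μ) :=
  AddGroupNorm.toNormedAddCommGroup
    { toFun := fun f => luxemburgNorm Φ μ (f : α →ₘ[μ] ℂ)
      map_zero' := luxemburgNorm_zero
      add_le' := luxemburgNorm_add
      neg' := luxemburgNorm_neg
      eq_zero_of_map_eq_zero' := eq_zero_of_luxemburgNorm }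

theorem norm_def (f : OrliczSpace Φ μ) : ‖f‖ = luxemburgNorm Φ μ (f : α →ₘ[μ] ℂ) := rfl

instance : NormedSpace ℂ (OrliczSpace Φ μ) where
  norm_smul_le := luxemburgNorm_smul_le

end OrliczSpace

end Orlicz

/-- A self-map `T` is topologically transitive if for all nonempty open sets `U`, `V` some iterate
satisfies `Tⁿ U ∩ V ≠ ∅`. -/
def IsTopologicallyTransitive {X : Type*} [TopologicalSpace X] (T : X → X) : Prop :=
  ∀ U V : Set X, IsOpen U → U.Nonempty → IsOpen V → V.Nonempty →
    ∃ n : ℕ, (T^[n] '' U ∩ V).Nonempty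

/-- A self-map `T` is hypercyclic if some orbit `{Tⁿ x : n ∈ ℕ}` is dense. -/
def IsHypercyclic {X : Type*} [TopologicalSpace X] (T : X → X) : Prop :=
  ∃ x : X, Dense (Set.range fun n : ℕ => T^[n] x)

section Group

variable {G : Type*} [Group G] [TopologicalSpace G]

/-- An element is periodic (compact) if the closed subgroup it generates is compact; it is
aperiodic otherwise. -/
def IsAperiodic (a : G) : Prop :=
  ¬ IsCompact (closure (Subgroup.zpowers a : Set G))

variable (G) in
/-- A weight: a bounded continuous function `w : G → (0, ∞)`. -/
structure GroupWeight where
  toFun : G → ℝ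
  continuous' : Continuous toFun
  pos' : ∀ x, 0 < toFun x
  bounded' : ∃ C, ∀ x, toFun x ≤ C

instance : CoeFun (GroupWeight G) (fun _ => G → ℝ) := ⟨GroupWeight.toFun⟩

/-- The convolution `f * δ_a`, that is, `x ↦ f (x a⁻¹)`. -/
def convDirac {β : Type*} (f : G → β) (a : G) : G → β := fun x => f (x * a⁻¹)

/-- `φ_n = ∏_{j=1}^n w * δ_{a⁻¹}^j`. -/
def weightPhi (a : G) (w : G → ℝ) (n : ℕ) : G → ℝ := fun x =>
  ∏ j ∈ Finset.Icc 1 n, convDirac w (a⁻¹ ^ j) x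

/-- `φ̃_n = (∏_{j=0}^{n-1} w * δ_a^j)⁻¹`. -/
def weightPhiTilde (a : G) (w : G → ℝ) (n : ℕ) : G → ℝ := fun x =>
  (∏ j ∈ Finset.range n, convDirac w (a ^ j) x)⁻¹

theorem GroupWeight.exists_bound (w : GroupWeight G) : ∃ C, 0 < C ∧ ∀ x, w x ≤ C := by
  obtain ⟨C, hC⟩ := w.bounded'
  exact ⟨C, (w.pos' 1).trans_le (hC 1), hC⟩

variable [IsTopologicalGroup G] [MeasurableSpace G] [BorelSpace G]

/-- The class of `w · (f * δ_a)`, for a class `f` of measurable functions. -/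
def weightedTranslationAE (μ : Measure G) [μ.IsMulRightInvariant] (a : G) (w : GroupWeight G)
    (f : G →ₘ[μ] ℂ) : G →ₘ[μ] ℂ :=
  AEEqFun.mk (fun x => (w x : ℂ))
      (Complex.continuous_ofReal.comp w.continuous').aestronglyMeasurable *
    f.compMeasurePreserving (fun x => x * a⁻¹) (measurePreserving_mul_right μ a⁻¹)

variable {Φ : YoungFunction} {μ : Measure G} [μ.IsMulRightInvariant]

theorem weightedTranslationAE_coeFn (a : G) (w : GroupWeight G) (f : G →ₘ[μ] ℂ) :
    weightedTranslationAE μ a w f =ᵐ[μ] fun x => (w x : ℂ) * convDirac f a x := by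
  filter_upwards [AEEqFun.coeFn_mul (AEEqFun.mk (fun x => (w x : ℂ))
      (Complex.continuous_ofReal.comp w.continuous').aestronglyMeasurable)
      (f.compMeasurePreserving (fun x => x * a⁻¹) (measurePreserving_mul_right μ a⁻¹)),
    AEEqFun.coeFn_mk (μ := μ) (fun x => (w x : ℂ))
      (Complex.continuous_ofReal.comp w.continuous').aestronglyMeasurable,
    AEEqFun.coeFn_compMeasurePreserving f (measurePreserving_mul_right μ a⁻¹)] with x h1 h2 h3
  rw [weightedTranslationAE, h1, Pi.mul_apply, h2, h3]
  rfl

theorem orliczModular_weightedTranslationAE_le (a : G) (w : GroupWeight G) {C : ℝ}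
    (hC : 0 < C) (hw : ∀ x, w x ≤ C) (f : G →ₘ[μ] ℂ) {c : ℝ} (hc : 0 ≤ c) :
    orliczModular Φ μ (C⁻¹ * c) (weightedTranslationAE μ a w f) ≤ orliczModular Φ μ c f := by
  have h1 : orliczModular Φ μ c (convDirac f a) = orliczModular Φ μ c f := by
    unfold orliczModular convDirac
    exact lintegral_mul_right_eq_self (μ := μ) (fun x => ENNReal.ofReal (Φ (c * ‖f x‖))) a⁻¹
  rw [← h1]
  refine orliczModular_mono (by positivity) ?_
  filter_upwards [weightedTranslationAE_coeFn a w f] with x hx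
  rw [hx, norm_mul, Complex.norm_real, Real.norm_of_nonneg (w.pos' x).le]
  calc C⁻¹ * c * (w x * ‖convDirac f a x‖) ≤ C⁻¹ * c * (C * ‖convDirac f a x‖) := by
        gcongr; exact hw x
    _ = c * ‖convDirac f a x‖ := by field_simp

variable (Φ μ) in
/-- The weighted translation `T_{a,w} f = w · (f * δ_a)`, a bounded operator on `L^Φ(G)`. -/
def weightedTranslation (a : G) (w : GroupWeight G) :
    OrliczSpace Φ μ →L[ℂ] OrliczSpace Φ μ :=
  LinearMap.mkContinuousOfExistsBound
    { toFun := fun f => ⟨weightedTranslationAE μ a w f, by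
        obtain ⟨f, c, hc, hf⟩ := f
        obtain ⟨C, hC, hw⟩ := w.exists_bound
        exact ⟨C⁻¹ * c, by positivity,
          (orliczModular_weightedTranslationAE_le a w hC hw f hc.le).trans_lt hf⟩⟩
      map_add' := fun f g => by
        apply Subtype.ext
        apply AEEqFun.ext
        have hq := (measurePreserving_mul_right μ a⁻¹).quasiMeasurePreserving.ae_eq
          (AEEqFun.coeFn_add (f : G →ₘ[μ] ℂ) (g : G →ₘ[μ] ℂ))
        filter_upwards [weightedTranslationAE_coeFn a w (f + g : G →ₘ[μ] ℂ),
          weightedTranslationAE_coeFn a w (f : G →ₘ[μ] ℂ),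
          weightedTranslationAE_coeFn a w (g : G →ₘ[μ] ℂ), hq,
          AEEqFun.coeFn_add (weightedTranslationAE μ a w f) (weightedTranslationAE μ a w g)]
          with x h1 h2 h3 h4 h5
        simp only [AddSubgroup.coe_add, AddMemClass.mk_add_mk]
        rw [h1, h5, Pi.add_apply, h2, h3]
        simp only [Function.comp, Pi.add_apply] at h4
        simp only [convDirac, h4, mul_add]
      map_smul' := fun z f => by
        apply Subtype.ext
        apply AEEqFun.ext
        have hq := (measurePreserving_mul_right μ a⁻¹).quasiMeasurePreserving.ae_eq
          (AEEqFun.coeFn_smul z (f : G →ₘ[μ] ℂ))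
        filter_upwards [weightedTranslationAE_coeFn a w (z • f : G →ₘ[μ] ℂ),
          weightedTranslationAE_coeFn a w (f : G →ₘ[μ] ℂ), hq,
          AEEqFun.coeFn_smul z (weightedTranslationAE μ a w f)] with x h1 h2 h4 h5
        simp only [OrliczSpace.coe_smul, RingHom.id_apply]
        rw [h1, h5, Pi.smul_apply, h2]
        simp only [Function.comp, Pi.smul_apply] at h4
        simp only [convDirac, h4, smul_eq_mul]
        ring }
    (by
      obtain ⟨C, hC, hw⟩ := w.exists_bound
      refine ⟨C, fun f => OrliczSpace.luxemburgNorm_le_mul hC f _ fun k hk => ?_⟩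
      rw [mul_inv]
      exact orliczModular_weightedTranslationAE_le a w hC hw _ (by positivity))

theorem weightedTranslation_coeFn (a : G) (w : GroupWeight G) (f : OrliczSpace Φ μ) :
    (weightedTranslation Φ μ a w f : G →ₘ[μ] ℂ) =ᵐ[μ]
      fun x => (w x : ℂ) * convDirac (f : G →ₘ[μ] ℂ) a x :=
  weightedTranslationAE_coeFn a w (f : G →ₘ[μ] ℂ)

end Group

end

/-! Write T for the translation. Two formulas carry the proof: T^n f (x a^n) = φ_n(x) f(x) and T^n f
(x) = f(x a^{-n}) / φ̃_n(x). Hence, for bounded functions living on a compact set K, smallness of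
φ_n on K means that T^n sends them close to 0, and smallness of φ̃_n on K means that they have
preimages under T^n close to 0. Condition (iii) says that both happen along a sequence, up to a part
of K of vanishing measure; `SmallWeights` is its version for a single n and a single tolerance.

(iii) → (i): bounded functions supported in compact sets are dense because Φ is doubling. For such f
and g, add to f (cut to the good set) a small preimage of g (cut likewise):
`exists_tendsto_iterate_of_smallWeights`.

(i) → (ii): Birkhoff's theorem, by Baire category. It needs the Orlicz space to be complete
(Borel–Cantelli and Fatou) and separable (comparison with L¹ on bounded functions).

(ii) → (iii): aperiodicity makes K a^n and K a^{-n} disjoint from K for large n. A dense orbit gives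
arbitrarily late n and a vector f with both f and T^n f near the indicator of K. By Chebyshev, off a
small set f and T^n f are near 1 at x, while T^n f at x a^n and f at x a^{-n} are near 0; the two
formulas then force φ_n(x) and φ̃_n(x) to be small: `smallWeights_of_norm_sub_lt`. -/

noncomputable section

/-! ### Orlicz spaces: modular estimates, completeness, density of truncations, separability. -/

section OrliczGeneral

variable {α : Type*} [MeasurableSpace α] {Φ : YoungFunction} {μ : Measure α}

theorem orliczModular_congr {c : ℝ} {f g : α → ℂ} (h : f =ᵐ[μ] g) :
    orliczModular Φ μ c f = orliczModular Φ μ c g := by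
  apply lintegral_congr_ae
  filter_upwards [h] with x hx
  rw [hx]

/-- Chebyshev's inequality for the modular. -/
theorem mul_measure_le_orliczModular {c δ : ℝ} (hc : 0 ≤ c) (hδ : 0 ≤ δ) {f : α → ℂ}
    (hf : AEStronglyMeasurable f μ) :
    ENNReal.ofReal (Φ (c * δ)) * μ {x | δ ≤ ‖f x‖} ≤ orliczModular Φ μ c f := by
  refine le_trans ?_ (mul_meas_ge_le_lintegral₀ (aemeasurable_modular (Φ := Φ) c hf)
    (ENNReal.ofReal (Φ (c * δ))))
  gcongr with x
  exact fun hx => ENNReal.ofReal_le_ofReal (Φ.mono (by positivity) (by gcongr))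

/-- A function bounded by `B` on `s` and vanishing outside `s` has modular at most
`Φ (c B) μ(s)`. -/
theorem orliczModular_le_of_bounded {c B : ℝ} (hc : 0 ≤ c) {s : Set α}
    (hs : MeasurableSet s) {f : α → ℂ} (h : ∀ᵐ x ∂μ, ‖f x‖ ≤ B ∧ (x ∉ s → f x = 0)) :
    orliczModular Φ μ c f ≤ ENNReal.ofReal (Φ (c * B)) * μ s := by
  rw [← lintegral_indicator_const hs]
  apply lintegral_mono_ae
  filter_upwards [h] with x hx
  by_cases hxs : x ∈ s
  · rw [Set.indicator_of_mem hxs]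
    exact ENNReal.ofReal_le_ofReal (Φ.mono (by positivity) (by gcongr; exact hx.1))
  · simp [hx.2 hxs, Φ.zero']

namespace OrliczSpace

/-- The element of `L^Φ(μ)` defined by a function with a finite modular. -/
def mk (f : α → ℂ) (hf : AEStronglyMeasurable f μ) (h : ∃ c > 0, orliczModular Φ μ c f < ∞) :
    OrliczSpace Φ μ :=
  ⟨AEEqFun.mk f hf, by
    obtain ⟨c, hc, h⟩ := h
    exact ⟨c, hc, (orliczModular_congr (AEEqFun.coeFn_mk f hf)).trans_lt h⟩⟩

theorem coeFn_mk (f : α → ℂ) (hf : AEStronglyMeasurable f μ)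
    (h : ∃ c > 0, orliczModular Φ μ c f < ∞) : (mk f hf h : α →ₘ[μ] ℂ) =ᵐ[μ] f :=
  AEEqFun.coeFn_mk f hf

theorem coeFn_sub (f g : OrliczSpace Φ μ) : ((f - g : OrliczSpace Φ μ) : α →ₘ[μ] ℂ) =ᵐ[μ]
    fun x => (f : α →ₘ[μ] ℂ) x - (g : α →ₘ[μ] ℂ) x :=
  AEEqFun.coeFn_sub (f : α →ₘ[μ] ℂ) (g : α →ₘ[μ] ℂ)

theorem ext_ae {f g : OrliczSpace Φ μ}
    (h : (f : α →ₘ[μ] ℂ) =ᵐ[μ] (g : α →ₘ[μ] ℂ)) : f = g :=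
  Subtype.ext (AEEqFun.ext h)

theorem norm_le_of_modular_le_one {ε : ℝ} (hε : 0 < ε) {f : OrliczSpace Φ μ}
    (h : orliczModular Φ μ ε⁻¹ (f : α →ₘ[μ] ℂ) ≤ 1) : ‖f‖ ≤ ε :=
  luxemburgNorm_le hε h

theorem modular_le_one_of_norm_lt {ε : ℝ} {f : OrliczSpace Φ μ} (h : ‖f‖ < ε) :
    orliczModular Φ μ ε⁻¹ (f : α →ₘ[μ] ℂ) ≤ 1 := by
  obtain ⟨k, ⟨hk, hk1⟩, hkε⟩ := exists_lt_of_csInf_lt (exists_modular_le_one f) h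
  have hε : 0 < ε := hk.trans hkε
  refine (orliczModular_mono (by positivity) (ae_of_all _ fun x => ?_)).trans hk1
  gcongr

/-- Chebyshev's inequality for the Luxemburg norm. -/
theorem measure_le_of_norm_lt {ε δ : ℝ} (hδ : 0 < δ) {f : OrliczSpace Φ μ} (h : ‖f‖ < ε) :
    μ {x | δ ≤ ‖(f : α →ₘ[μ] ℂ) x‖} ≤ (ENNReal.ofReal (Φ (ε⁻¹ * δ)))⁻¹ := by
  have hε : 0 < ε := (norm_nonneg f).trans_lt h
  rw [ENNReal.le_inv_iff_mul_le, mul_comm]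
  exact (mul_measure_le_orliczModular (by positivity) hδ.le
    (f : α →ₘ[μ] ℂ).aestronglyMeasurable).trans (modular_le_one_of_norm_lt h)

/-- The norm is at most ε once the modular at scale 1/ε is at most 1, so norm convergence can be
checked by integral estimates, one scale at a time. -/
theorem tendsto_zero_of_modular {ι : Type*} {l : Filter ι} {u : ι → OrliczSpace Φ μ}
    (h : ∀ c > 0, Tendsto (fun i => orliczModular Φ μ c (u i : α →ₘ[μ] ℂ)) l (𝓝 0)) :
    Tendsto u l (𝓝 0) := by
  rw [tendsto_zero_iff_norm_tendsto_zero, Metric.tendsto_nhds]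
  intro ε hε
  filter_upwards [(h (ε / 2)⁻¹ (by positivity)).eventually (gt_mem_nhds one_pos)] with i hi
  rw [Real.dist_0_eq_abs, abs_of_nonneg (norm_nonneg _)]
  exact (norm_le_of_modular_le_one (by positivity) hi.le).trans_lt (by linarith)

theorem tendsto_of_modular {ι : Type*} {l : Filter ι} {u : ι → OrliczSpace Φ μ}
    {f : OrliczSpace Φ μ}
    (h : ∀ c > 0, Tendsto (fun i => orliczModular Φ μ c
      fun x => (u i : α →ₘ[μ] ℂ) x - (f : α →ₘ[μ] ℂ) x) l (𝓝 0)) :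
    Tendsto u l (𝓝 f) := by
  rw [← tendsto_sub_nhds_zero_iff]
  refine tendsto_zero_of_modular fun c hc => ?_
  simpa only [orliczModular_congr (coeFn_sub _ _)] using h c hc

/-- The Riesz-Fischer theorem for Orlicz spaces. -/
instance : CompleteSpace (OrliczSpace Φ μ) := by
  -- Increments below (1/4)^n in norm, tested at height (1/2)^n, leave the ratio 2^n in Chebyshev's
  -- inequality. Convexity gives Φ(2^n) ≥ 2^n Φ(1), so the exceptional measures are summable and
  -- Borel–Cantelli applies.
  refine Metric.complete_of_convergent_controlled_sequences (fun n => (1 / 4 : ℝ) ^ n)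
    (fun n => by positivity) fun u hu => ?_
  have hΦ1 : 0 < Φ 1 := Φ.pos' 1 one_pos
  have hmeas : ∀ n, μ {x | (1 / 2 : ℝ) ^ n ≤
      ‖((u n - u (n + 1) : OrliczSpace Φ μ) : α →ₘ[μ] ℂ) x‖} ≤
      ENNReal.ofReal ((Φ 1)⁻¹ * (1 / 2) ^ n) := by
    intro n
    have h1 : ‖u n - u (n + 1)‖ < (1 / 4 : ℝ) ^ n := by
      rw [← dist_eq_norm]; exact hu n n (n + 1) le_rfl (Nat.le_succ n)
    refine (measure_le_of_norm_lt (by positivity) h1).trans ?_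
    have h2 : ((1 / 4 : ℝ) ^ n)⁻¹ * (1 / 2) ^ n = 2 ^ n := by
      rw [← inv_pow, ← mul_pow]; norm_num
    have h3 : 2 ^ n * Φ 1 ≤ Φ (2 ^ n) := by
      have := Φ.scale_le (a := (1 / 2 : ℝ) ^ n) (t := 2 ^ n) (by positivity)
        (pow_le_one₀ (by norm_num) (by norm_num))
      rw [← mul_pow] at this
      norm_num at this
      rw [← le_div_iff₀' (by positivity)]
      simpa [div_eq_inv_mul] using this
    rw [h2, ← ENNReal.ofReal_inv_of_pos (by nlinarith [pow_pos (two_pos (α := ℝ)) n])]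
    refine ENNReal.ofReal_le_ofReal ?_
    calc (Φ (2 ^ n))⁻¹ ≤ (2 ^ n * Φ 1)⁻¹ := by gcongr
      _ = _ := by rw [mul_inv, mul_comm]; simp
  have hsum : ∑' n, μ {x | (1 / 2 : ℝ) ^ n ≤
      ‖((u n - u (n + 1) : OrliczSpace Φ μ) : α →ₘ[μ] ℂ) x‖} ≠ ∞ := by
    refine ne_top_of_le_ne_top ?_ (ENNReal.tsum_le_tsum hmeas)
    exact (summable_geometric_two.mul_left _).tsum_ofReal_ne_top
  have hcau : ∀ᵐ x ∂μ, ∃ l, Tendsto (fun n => (u n : α →ₘ[μ] ℂ) x) atTop (𝓝 l) := by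
    filter_upwards [ae_eventually_notMem hsum,
      ae_all_iff.2 fun n => coeFn_sub (u n) (u (n + 1))] with x hx hx'
    refine cauchySeq_tendsto_of_complete ?_
    obtain ⟨N, hN⟩ := eventually_atTop.1 hx
    rw [← cauchySeq_shift (k := N)]
    refine cauchySeq_of_le_geometric (1 / 2) 1 (by norm_num) fun n => ?_
    have h1 := hN (n + N) (Nat.le_add_left _ _)
    simp only [not_le, hx'] at h1
    rw [dist_eq_norm, one_mul, show n + 1 + N = n + N + 1 by ring]
    exact h1.le.trans (pow_le_pow_of_le_one (by norm_num) (by norm_num) (Nat.le_add_right _ _))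
  obtain ⟨g, hgm, hg⟩ := exists_stronglyMeasurable_limit_of_tendsto_ae
    (fun n => (u n : α →ₘ[μ] ℂ).aestronglyMeasurable) hcau
  -- Fatou's lemma passes the bound for u N - u m to the pointwise limit as m → ∞.
  have hfatou : ∀ N, orliczModular Φ μ ((1 / 4 : ℝ) ^ N)⁻¹
      (fun x => (u N : α →ₘ[μ] ℂ) x - g x) ≤ 1 := by
    intro N
    have hlim : ∀ᵐ x ∂μ, Tendsto (fun m => ENNReal.ofReal (Φ (((1 / 4 : ℝ) ^ N)⁻¹ *
        ‖((u N - u m : OrliczSpace Φ μ) : α →ₘ[μ] ℂ) x‖))) atTop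
        (𝓝 (ENNReal.ofReal (Φ (((1 / 4 : ℝ) ^ N)⁻¹ * ‖(u N : α →ₘ[μ] ℂ) x - g x‖)))) := by
      filter_upwards [hg, ae_all_iff.2 fun m => coeFn_sub (u N) (u m)] with x hx hx'
      simp only [hx']
      refine ENNReal.tendsto_ofReal ((Φ.continuous'.tendsto _).comp ?_)
      exact ((tendsto_const_nhds.sub hx).norm).const_mul _
    calc _ = ∫⁻ x, liminf (fun m => ENNReal.ofReal (Φ (((1 / 4 : ℝ) ^ N)⁻¹ *
        ‖((u N - u m : OrliczSpace Φ μ) : α →ₘ[μ] ℂ) x‖))) atTop ∂μ := by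
          apply lintegral_congr_ae
          filter_upwards [hlim] with x hx using hx.liminf_eq.symm
      _ ≤ liminf (fun m => ∫⁻ x, ENNReal.ofReal (Φ (((1 / 4 : ℝ) ^ N)⁻¹ *
        ‖((u N - u m : OrliczSpace Φ μ) : α →ₘ[μ] ℂ) x‖)) ∂μ) atTop :=
          lintegral_liminf_le' fun m => aemeasurable_modular _ (AEEqFun.aestronglyMeasurable _)
      _ ≤ 1 := by
          refine liminf_le_of_frequently_le' (Eventually.frequently ?_)
          filter_upwards [eventually_ge_atTop N] with m hm
          refine modular_le_one_of_norm_lt ?_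
          rw [← dist_eq_norm]
          exact hu N N m le_rfl hm
  -- Only the differences u N - g are known so far to have a finite modular; the limit is therefore
  -- recovered as u 0 - (u 0 - g).
  have hmk : ∀ N, ∃ d : OrliczSpace Φ μ, (d : α →ₘ[μ] ℂ) =ᵐ[μ]
      fun x => (u N : α →ₘ[μ] ℂ) x - g x := fun N =>
    ⟨mk _ ((AEEqFun.aestronglyMeasurable _).sub hgm.aestronglyMeasurable)
      ⟨_, by positivity, (hfatou N).trans_lt ENNReal.one_lt_top⟩, coeFn_mk _ _ _⟩
  choose d hd using hmk
  refine ⟨u 0 - d 0, ?_⟩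
  have heq : ∀ N, u N - (u 0 - d 0) = d N := fun N => ext_ae <| by
    filter_upwards [coeFn_sub (u N) (u 0 - d 0), coeFn_sub (u 0) (d 0), hd N, hd 0]
      with x h1 h2 h3 h4
    rw [h1, h2, h3, h4]; ring
  rw [tendsto_iff_norm_sub_tendsto_zero]
  refine squeeze_zero (fun _ => norm_nonneg _) (fun N => ?_)
    (tendsto_pow_atTop_nhds_zero_of_lt_one (r := (1 / 4 : ℝ)) (by norm_num) (by norm_num))
  rw [heq]
  refine norm_le_of_modular_le_one (by positivity) ?_
  rw [orliczModular_congr (hd N)]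
  exact hfatou N

/-- Under a global doubling condition, the modular is finite at every scale. -/
theorem modular_lt_top {M : ℝ} (hM : ∀ t > 0, Φ (2 * t) ≤ M * Φ t) (f : OrliczSpace Φ μ)
    {c : ℝ} (hc : 0 ≤ c) : orliczModular Φ μ c (f : α →ₘ[μ] ℂ) < ∞ := by
  obtain ⟨f, b, hb, hf⟩ := f
  have hM0 : 0 ≤ M := by
    have h1 := hM 1 one_pos
    have h2 := Φ.pos' (2 * 1) (by norm_num)
    have h3 := Φ.pos' 1 one_pos
    exact (pos_of_mul_pos_left (h2.trans_le h1) h3.le).le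
  have hdouble : ∀ (e : ℝ), 0 ≤ e → orliczModular Φ μ (2 * e) f ≤
      ENNReal.ofReal M * orliczModular Φ μ e f := by
    intro e he
    unfold orliczModular
    rw [← lintegral_const_mul' _ _ ENNReal.ofReal_ne_top]
    refine lintegral_mono fun x => ?_
    dsimp only
    rw [← ENNReal.ofReal_mul hM0, mul_assoc]
    refine ENNReal.ofReal_le_ofReal ?_
    rcases (mul_nonneg he (norm_nonneg (f x))).eq_or_lt with h | h
    · simp [← h, Φ.zero']
    · exact hM _ h
  have hpow : ∀ n : ℕ, orliczModular Φ μ (2 ^ n * b) f < ∞ := by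
    intro n
    induction n with
    | zero => simpa using hf
    | succ n ih =>
      rw [pow_succ', mul_assoc]
      exact (hdouble _ (by positivity)).trans_lt (ENNReal.mul_lt_top ENNReal.ofReal_lt_top ih)
  obtain ⟨n, hn⟩ := pow_unbounded_of_one_lt (c / b) (one_lt_two (α := ℝ))
  refine (orliczModular_mono hc (ae_of_all _ fun x => ?_)).trans_lt (hpow n)
  gcongr
  exact ((div_lt_iff₀ hb).1 hn).le

variable (Φ μ) in
/-- The elements of `L^Φ(μ)` bounded by `C` and vanishing outside `s`. -/
def boundedOn (s : Set α) (C : ℝ) : Set (OrliczSpace Φ μ) :=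
  {f | ∀ᵐ x ∂μ, ‖(f : α →ₘ[μ] ℂ) x‖ ≤ C ∧ (x ∉ s → (f : α →ₘ[μ] ℂ) x = 0)}

/-- Under a global doubling condition, truncations converge. -/
theorem exists_tendsto_boundedOn {M : ℝ} (hM : ∀ t > 0, Φ (2 * t) ≤ M * Φ t)
    {s : ℕ → Set α} (hs : ∀ n, MeasurableSet (s n)) (hmono : Monotone s)
    (hU : ⋃ n, s n = Set.univ) (f : OrliczSpace Φ μ) :
    ∃ u : ℕ → OrliczSpace Φ μ, (∀ n, u n ∈ boundedOn Φ μ (s n) n) ∧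
      Tendsto u atTop (𝓝 f) := by
  set F : α → ℂ := ⇑(f : α →ₘ[μ] ℂ) with hF
  have hFm : StronglyMeasurable F := (f : α →ₘ[μ] ℂ).stronglyMeasurable
  set A : ℕ → Set α := fun n => s n ∩ {x | ‖F x‖ ≤ n} with hA
  have hAm : ∀ n, MeasurableSet (A n) := fun n =>
    (hs n).inter (measurableSet_le hFm.norm.measurable measurable_const)
  have hmk : ∀ n, ∃ u : OrliczSpace Φ μ, (u : α →ₘ[μ] ℂ) =ᵐ[μ] (A n).indicator F := fun n =>
    ⟨mk _ (hFm.indicator (hAm n)).aestronglyMeasurable ⟨1, one_pos,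
      (orliczModular_mono zero_le_one (ae_of_all _ fun x => by
        gcongr; exact norm_indicator_le_norm_self F x)).trans_lt
        (modular_lt_top hM f zero_le_one)⟩, coeFn_mk _ _ _⟩
  choose u hu using hmk
  refine ⟨u, fun n => ?_, tendsto_of_modular fun c hc => ?_⟩
  · filter_upwards [hu n] with x hx
    rw [hx]
    by_cases hxA : x ∈ A n
    · rw [Set.indicator_of_mem hxA]
      exact ⟨hxA.2, fun h => absurd hxA.1 h⟩
    · rw [Set.indicator_of_notMem hxA]
      simp
  -- The dominating function Φ(c|F|) must be integrable for every c, not merely for some c; this is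
  -- what the doubling condition provides.
  · have hlim := tendsto_lintegral_of_dominated_convergence' (μ := μ)
      (F := fun n x => ENNReal.ofReal (Φ (c * ‖(u n : α →ₘ[μ] ℂ) x - F x‖))) (f := fun _ => 0)
      (fun x => ENNReal.ofReal (Φ (c * ‖F x‖)))
      (fun n => aemeasurable_modular c ((AEEqFun.aestronglyMeasurable _).sub
        hFm.aestronglyMeasurable)) (fun n => ?_) (modular_lt_top hM f hc.le).ne ?_
    · rw [lintegral_zero] at hlim
      exact hlim
    · filter_upwards [hu n] with x hx
      rw [hx]
      refine ENNReal.ofReal_le_ofReal (Φ.mono (by positivity) ?_)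
      gcongr
      by_cases hxA : x ∈ A n
      · simp [hxA]
      · simp [hxA]
    · filter_upwards [ae_all_iff.2 hu] with x hx
      refine tendsto_const_nhds.congr' ?_
      obtain ⟨n₁, hn₁⟩ := Set.mem_iUnion.1 (hU ▸ Set.mem_univ x : x ∈ ⋃ n, s n)
      obtain ⟨n₂, hn₂⟩ := exists_nat_ge ‖F x‖
      filter_upwards [eventually_ge_atTop (max n₁ n₂)] with n hn
      have hxA : x ∈ A n := ⟨hmono ((le_max_left _ _).trans hn) hn₁,
        hn₂.trans (by exact_mod_cast (le_max_right _ _).trans hn)⟩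
      simp [hx, hxA, Φ.zero']

/-- Uniformly bounded functions supported in a set of finite measure form a separable set. -/
theorem isSeparable_boundedOn [IsSeparable μ] {s : Set α} (hs : MeasurableSet s)
    (hμ : μ s ≠ ∞) {C : ℝ} (hC : 0 < C) :
    TopologicalSpace.IsSeparable (boundedOn Φ μ s C) := by
  have : Fact ((1 : ℝ≥0∞) ≤ 1) := ⟨le_rfl⟩
  have : Fact ((1 : ℝ≥0∞) ≠ ∞) := ⟨ENNReal.one_ne_top⟩
  -- The set is the image of a subset of the separable space L¹ under the identity map, which is
  -- continuous there because differences are bounded by 2C.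
  let D : Set (Lp ℂ 1 μ) := {f | ∀ᵐ x ∂μ, ‖f x‖ ≤ C ∧ (x ∉ s → f x = 0)}
  have hD : ∀ f : D, ((f : Lp ℂ 1 μ) : α →ₘ[μ] ℂ) ∈ OrliczSpace Φ μ := fun f =>
    ⟨1, one_pos, (orliczModular_le_of_bounded zero_le_one hs f.2).trans_lt
      (ENNReal.mul_lt_top ENNReal.ofReal_lt_top hμ.lt_top)⟩
  let ι : D → OrliczSpace Φ μ := fun f => ⟨f, hD f⟩
  have hι : Continuous ι := by
    refine continuous_iff_continuousAt.2 fun f => tendsto_of_modular fun c hc => ?_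
    have hle : ∀ g : D, orliczModular Φ μ c
        (fun x => (ι g : α →ₘ[μ] ℂ) x - (ι f : α →ₘ[μ] ℂ) x) ≤
        ENNReal.ofReal (Φ (c * (2 * C)) / (2 * C)) * edist (g : Lp ℂ 1 μ) (f : Lp ℂ 1 μ) := by
      intro g
      rw [Lp.edist_def, eLpNorm_one_eq_lintegral_enorm,
        ← lintegral_const_mul' _ _ ENNReal.ofReal_ne_top]
      apply lintegral_mono_ae
      filter_upwards [f.2, g.2] with x hf hg
      change ENNReal.ofReal (Φ (c * ‖(g : Lp ℂ 1 μ) x - (f : Lp ℂ 1 μ) x‖)) ≤ _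
      rw [Pi.sub_apply, ← ofReal_norm, ← ENNReal.ofReal_mul
        (div_nonneg (Φ.nonneg (by positivity)) (by positivity))]
      refine ENNReal.ofReal_le_ofReal ?_
      set t := ‖(g : Lp ℂ 1 μ) x - (f : Lp ℂ 1 μ) x‖ with ht
      have ht2 : t ≤ 2 * C := (norm_sub_le _ _).trans (by linarith [hf.1, hg.1])
      -- Below 2C, the convex function t ↦ Φ(ct) lies under its chord from 0, so the modular is at
      -- most a constant times the L¹ distance.
      have h1 := Φ.scale_le (a := t / (2 * C)) (t := c * (2 * C)) (by positivity)
        ((div_le_one (by positivity)).2 ht2)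
      calc Φ (c * t) = Φ (t / (2 * C) * (c * (2 * C))) := by congr 1; field_simp
        _ ≤ _ := h1
        _ = _ := by ring
    refine tendsto_of_tendsto_of_tendsto_of_le_of_le tendsto_const_nhds ?_
      (fun _ => zero_le) hle
    have h0 : Tendsto (fun g : D => edist (g : Lp ℂ 1 μ) (f : Lp ℂ 1 μ)) (𝓝 f) (𝓝 0) := by
      have : Continuous fun g : D => edist (g : Lp ℂ 1 μ) (f : Lp ℂ 1 μ) := by fun_prop
      simpa using this.tendsto f
    simpa using ENNReal.Tendsto.const_mul h0 (Or.inr ENNReal.ofReal_ne_top)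
  have : SecondCountableTopology (Lp ℂ 1 μ) := inferInstance
  refine (TopologicalSpace.isSeparable_range hι).mono fun f hf => ?_
  have hmem : (f : α →ₘ[μ] ℂ) ∈ Lp ℂ 1 μ := by
    rw [Lp.mem_Lp_iff_eLpNorm_lt_top, eLpNorm_one_eq_lintegral_enorm]
    calc ∫⁻ x, ‖(f : α →ₘ[μ] ℂ) x‖ₑ ∂μ ≤ ∫⁻ x, s.indicator (fun _ => ENNReal.ofReal C) x ∂μ := by
          apply lintegral_mono_ae
          filter_upwards [hf] with x hx
          by_cases hxs : x ∈ s
          · rw [Set.indicator_of_mem hxs, ← ofReal_norm]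
            exact ENNReal.ofReal_le_ofReal hx.1
          · simp [hx.2 hxs]
      _ < ∞ := by
          rw [lintegral_indicator_const hs]
          exact ENNReal.mul_lt_top ENNReal.ofReal_lt_top hμ.lt_top
  exact ⟨⟨⟨f, hmem⟩, hf⟩, rfl⟩

theorem separableSpace [IsSeparable μ] [SigmaFinite μ] {M : ℝ}
    (hM : ∀ t > 0, Φ (2 * t) ≤ M * Φ t) :
    TopologicalSpace.SeparableSpace (OrliczSpace Φ μ) := by
  rw [← TopologicalSpace.isSeparable_univ_iff]
  refine (TopologicalSpace.IsSeparable.iUnion fun n : ℕ =>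
    isSeparable_boundedOn (Φ := Φ) (μ := μ) (measurableSet_spanningSets μ n)
      -- The bound n + 1 instead of n keeps the constant positive at n = 0.
      (measure_spanningSets_lt_top μ n).ne (C := n + 1) (by positivity)).closure.mono ?_
  intro f _
  obtain ⟨u, hu, hlim⟩ := exists_tendsto_boundedOn hM (measurableSet_spanningSets μ)
    (monotone_spanningSets μ) (iUnion_spanningSets μ) f
  refine mem_closure_of_tendsto hlim (Eventually.of_forall fun n => Set.mem_iUnion.2 ⟨n, ?_⟩)
  have h := hu n
  simp only [boundedOn, Set.mem_ofPred_eq] at h ⊢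
  filter_upwards [h] with x hx using ⟨hx.1.trans (by simp), hx.2⟩

end OrliczSpace

end OrliczGeneral

/-! ### Transitivity and dense orbits. -/

section Dynamics

/-- Birkhoff's transitivity theorem. -/
theorem IsTopologicallyTransitive.isHypercyclic {X : Type*} [TopologicalSpace X] [Nonempty X]
    [BaireSpace X] [SecondCountableTopology X] {T : X → X} (hT : Continuous T)
    (h : IsTopologicallyTransitive T) : IsHypercyclic T := by
  let B := TopologicalSpace.countableBasis X
  -- A point of this intersection has an orbit meeting every basic open set; transitivity makes each
  -- open set in the intersection dense.
  have hd : Dense (⋂ V ∈ B, ⋃ n : ℕ, T^[n] ⁻¹' V) := by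
    refine dense_biInter_of_isOpen (fun V hV => isOpen_iUnion fun n =>
      (TopologicalSpace.isOpen_of_mem_countableBasis hV).preimage (hT.iterate n))
      (TopologicalSpace.countable_countableBasis X) fun V hV => ?_
    refine dense_iff_inter_open.2 fun U hU hUne => ?_
    obtain ⟨n, _, ⟨x, hx, rfl⟩, hxV⟩ := h U V hU hUne
      (TopologicalSpace.isOpen_of_mem_countableBasis hV)
      (TopologicalSpace.nonempty_of_mem_countableBasis hV)
    exact ⟨x, hx, Set.mem_iUnion.2 ⟨n, hxV⟩⟩
  obtain ⟨x, hx⟩ := hd.nonempty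
  refine ⟨x, (TopologicalSpace.isBasis_countableBasis X).dense_iff.2 fun V hV _ => ?_⟩
  obtain ⟨n, hn⟩ := Set.mem_iUnion.1 (Set.mem_iInter₂.1 hx V hV)
  exact ⟨_, hn, n, rfl⟩

/-- In a T1 space without isolated points, a dense orbit provides arbitrarily late
transitions between nonempty open sets. -/
theorem IsHypercyclic.frequently {X : Type*} [TopologicalSpace X] [T1Space X]
    [∀ x : X, (𝓝[≠] x).NeBot] {T : X → X} (h : IsHypercyclic T) {U V : Set X} (hU : IsOpen U)
    (hUne : U.Nonempty) (hV : IsOpen V) (hVne : V.Nonempty) :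
    ∃ᶠ n in atTop, (T^[n] '' U ∩ V).Nonempty := by
  obtain ⟨x, hx⟩ := h
  obtain ⟨_, hm, m, rfl⟩ := hx.inter_open_nonempty U hU hUne
  refine frequently_atTop.2 fun N => ?_
  -- Discarding the first m + N orbit points keeps the orbit dense, so V is visited at a time n ≥ m
  -- + N, at least N steps after the visit to U at time m.
  obtain ⟨_, hyV, ⟨n, rfl⟩, hn⟩ := (hx.sdiff_finite
    (((Set.finite_lt_nat (m + N)).image fun n => T^[n] x))).inter_open_nonempty V hV hVne
  have hle : m + N ≤ n := by
    by_contra hlt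
    exact hn ⟨n, not_le.1 hlt, rfl⟩
  refine ⟨n - m, by omega, T^[n] x, ⟨T^[m] x, hm, ?_⟩, hyV⟩
  rw [← Function.iterate_add_apply, Nat.sub_add_cancel (by omega)]

end Dynamics

/-! ### Powers of an aperiodic element leave every compact set. -/

section Aperiodic

open scoped Pointwise

theorem IsAperiodic.noncompactSpace {G : Type*} [Group G] [TopologicalSpace G] {a : G}
    (ha : IsAperiodic a) : NoncompactSpace G := by
  by_contra h
  rw [← not_compactSpace_iff, not_not] at h
  exact ha isClosed_closure.isCompact

variable {G : Type*} [Group G] [TopologicalSpace G] [IsTopologicalGroup G]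

/-- If the powers of an element cluster at some point, then they cluster at every point of the
closed subgroup it generates. -/
theorem mapClusterPt_of_mem_closure_zpowers {a b x : G}
    (h : MapClusterPt b atTop (fun n : ℕ => a ^ n))
    (hx : x ∈ (Subgroup.zpowers a).topologicalClosure) :
    MapClusterPt x atTop (fun n : ℕ => a ^ n) := by
  refine mapClusterPt_iff_frequently.2 fun W hW => frequently_atTop.2 fun N => ?_
  obtain ⟨W', hW'W, hW'o, hxW'⟩ := mem_nhds_iff.1 hW
  obtain ⟨_, hk, k, rfl⟩ := mem_closure_iff.1 hx W' hW'o hxW'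
  -- Two powers near b have quotient near 1, so a^k a^{-n₁} a^{n₂} stays near a^k; taking n₂ much
  -- later than n₁ makes the total exponent a large natural number.
  have hO : {p : G × G | a ^ k * (p.1⁻¹ * p.2) ∈ W'} ∈ 𝓝 (b, b) := by
    refine (hW'o.preimage (by fun_prop :
      Continuous fun p : G × G => a ^ k * (p.1⁻¹ * p.2))).mem_nhds ?_
    simpa using hk
  rw [nhds_prod_eq, mem_prod_self_iff] at hO
  obtain ⟨S, hS, hSO⟩ := hO
  obtain ⟨n₁, hn₁⟩ := (h.frequently hS).exists
  obtain ⟨n₂, hn₂, hn₂'⟩ := frequently_atTop.1 (h.frequently hS) (n₁ + N + k.natAbs)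
  have hmem : a ^ k * ((a ^ n₁)⁻¹ * a ^ n₂) ∈ W' := hSO (Set.mk_mem_prod hn₁ hn₂')
  refine ⟨(k + n₂ - n₁).toNat, by omega, hW'W ?_⟩
  convert hmem using 1
  have h0 : ((k + n₂ - n₁).toNat : ℤ) = k + (-n₁ + n₂) := by omega
  rw [← zpow_natCast, h0, zpow_add, zpow_add, zpow_neg, zpow_natCast, zpow_natCast]

/-- If the powers of an element cluster at some point of a locally compact group, then the closed
subgroup it generates is compact. -/
theorem isCompact_closure_zpowers_of_mapClusterPt [LocallyCompactSpace G] {a b : G}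
    (h : MapClusterPt b atTop (fun n : ℕ => a ^ n)) :
    IsCompact (closure (Subgroup.zpowers a : Set G)) := by
  set H := (Subgroup.zpowers a).topologicalClosure with hH
  have hcl : ∀ x ∈ H, MapClusterPt x atTop (fun n : ℕ => a ^ n) :=
    fun x hx => mapClusterPt_of_mem_closure_zpowers h hx
  have haH : ∀ n : ℕ, a ^ n ∈ H := fun n =>
    H.pow_mem ((Subgroup.zpowers a).le_topologicalClosure (Subgroup.mem_zpowers a)) n
  obtain ⟨V, hVc, hV⟩ := exists_compact_mem_nhds (1 : G)
  have hHcl : IsClosed (H : Set G) := (Subgroup.zpowers a).isClosed_topologicalClosure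
  -- Points of H in V return to V after a positive number of multiplications by a⁻¹; by compactness
  -- this number is bounded. The strictly positive exponent n + 1 is what contradicts minimality
  -- below.
  have hcover : (V ∩ H : Set G) ⊆ ⋃ n : ℕ, (fun x => (a ^ (n + 1))⁻¹ * x) ⁻¹' interior V := by
    rintro x ⟨-, hx⟩
    have hmem : {y | y⁻¹ * x ∈ interior V} ∈ 𝓝 x := by
      refine (isOpen_interior.preimage (by fun_prop : Continuous fun y => y⁻¹ * x)).mem_nhds ?_
      simpa using mem_interior_iff_mem_nhds.2 hV
    obtain ⟨n, hn, hn'⟩ := frequently_atTop.1 ((hcl x hx).frequently hmem) 1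
    refine Set.mem_iUnion.2 ⟨n - 1, ?_⟩
    simpa [Nat.sub_add_cancel hn] using hn'
  obtain ⟨t, ht⟩ := (hVc.inter_right hHcl).elim_finite_subcover _
    (fun n => isOpen_interior.preimage (continuous_const_mul _)) hcover
  obtain ⟨N, hN⟩ : ∃ N, ∀ n ∈ t, n < N :=
    ⟨t.sup id + 1, fun n hn => Nat.lt_succ_of_le (Finset.le_sup (f := id) hn)⟩
  have hK : IsCompact (⋃ n ∈ Finset.range (N + 1), (fun x => (a ^ n)⁻¹ * x) '' V) :=
    Finset.isCompact_biUnion _ fun n _ => hVc.image (continuous_const_mul _)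
  refine hK.of_isClosed_subset hHcl fun x hx => ?_
  have hex : ∃ n : ℕ, a ^ n * x ∈ V := by
    have hmem : {y | y * x ∈ V} ∈ 𝓝 x⁻¹ := by
      refine (continuous_mul_const x).continuousAt.preimage_mem_nhds ?_
      simpa using hV
    exact ((hcl x⁻¹ (H.inv_mem hx)).frequently hmem).exists
  classical
  -- For the least n with a^n x ∈ V, the bounded return time forces n ≤ k < N, since otherwise a
  -- smaller exponent would work. So finitely many translates of V cover H.
  have hmin := Nat.find_spec hex
  set n := Nat.find hex with hn
  obtain ⟨k, hk, hk'⟩ := Set.mem_iUnion₂.1 (ht ⟨hmin, H.mul_mem (haH n) hx⟩)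
  have hnk : n ≤ k := by
    by_contra hlt
    refine Nat.find_min hex (m := n - (k + 1)) (by omega) ?_
    have h1 : a ^ n = a ^ (k + 1) * a ^ (n - (k + 1)) := by
      rw [← pow_add]; congr 1; omega
    have h2 := interior_subset hk'
    rw [h1] at h2
    simpa [mul_assoc] using h2
  refine Set.mem_iUnion₂.2 ⟨n, Finset.mem_range.2 (by have := hN k hk; omega), _, hmin, ?_⟩
  simp

/-- The translates of a compact set by the powers of an aperiodic element eventually leave it. -/
theorem IsAperiodic.eventually_mul_notMem [LocallyCompactSpace G] {a : G} (ha : IsAperiodic a)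
    {K : Set G} (hK : IsCompact K) :
    ∀ᶠ n : ℕ in atTop, ∀ x ∈ K, x * a ^ n ∉ K ∧ x * (a ^ n)⁻¹ ∉ K := by
  have hC : IsCompact (K⁻¹ * K) := hK.inv.mul hK
  have hev : ∀ᶠ n : ℕ in atTop, a ^ n ∉ K⁻¹ * K := by
    by_contra hne
    rw [not_eventually] at hne
    simp only [not_not] at hne
    obtain ⟨b, -, hb⟩ := hC.exists_mapClusterPt_of_frequently hne
    exact ha (isCompact_closure_zpowers_of_mapClusterPt hb)
  filter_upwards [hev] with n hn x hx
  refine ⟨fun h => hn ?_, fun h => hn ?_⟩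
  · exact ⟨x⁻¹, Set.inv_mem_inv.2 hx, x * a ^ n, h, by simp⟩
  · exact ⟨(x * (a ^ n)⁻¹)⁻¹, Set.inv_mem_inv.2 h, x, hx, by simp⟩

end Aperiodic

/-! ### Iterates of the weighted translation and the weight products. -/

section WeightedTranslation

variable {G : Type*} [Group G]

theorem weightPhi_pos (a : G) {w : G → ℝ} (hw : ∀ x, 0 < w x) (n : ℕ) (x : G) :
    0 < weightPhi a w n x := Finset.prod_pos fun _ _ => hw _

theorem weightPhiTilde_pos (a : G) {w : G → ℝ} (hw : ∀ x, 0 < w x) (n : ℕ) (x : G) :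
    0 < weightPhiTilde a w n x := inv_pos.2 (Finset.prod_pos fun _ _ => hw _)

/-- The reindexing j ↦ n - j matches the factors. It links the two forms of the iterate, read at x
and at x a^n. -/
theorem weightPhiTilde_mul_pow (a : G) (w : G → ℝ) (n : ℕ) (x : G) :
    weightPhiTilde a w n (x * a ^ n) = (weightPhi a w n x)⁻¹ := by
  unfold weightPhiTilde weightPhi convDirac
  congr 1
  refine Finset.prod_bij' (fun j _ => n - j) (fun j _ => n - j) ?_ ?_ ?_ ?_ fun j hj => ?_
  · intro j hj; simp only [Finset.mem_range, Finset.mem_Icc] at hj ⊢; omega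
  · intro j hj; simp only [Finset.mem_range, Finset.mem_Icc] at hj ⊢; omega
  · intro j hj; simp only [Finset.mem_range] at hj; omega
  · intro j hj; simp only [Finset.mem_Icc] at hj; omega
  · rw [inv_pow, inv_inv, mul_assoc, pow_sub a (Finset.mem_range.1 hj).le]

theorem weightPhiTilde_succ (a : G) (w : G → ℝ) (n : ℕ) (x : G) :
    (weightPhiTilde a w (n + 1) x)⁻¹ = w x * (weightPhiTilde a w n (x * a⁻¹))⁻¹ := by
  simp only [weightPhiTilde, inv_inv, convDirac, Finset.prod_range_succ', pow_zero, inv_one,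
    mul_one]
  rw [mul_comm]
  congr 1
  refine Finset.prod_congr rfl fun j _ => ?_
  rw [mul_assoc, pow_succ, mul_inv_rev]

variable [TopologicalSpace G] [IsTopologicalGroup G]

theorem continuous_weightPhiTilde (a : G) (w : GroupWeight G) (n : ℕ) :
    Continuous (weightPhiTilde a w n) :=
  (continuous_finsetProd _ fun _ _ => w.continuous'.comp (continuous_mul_const _)).inv₀
    fun _ => Finset.prod_ne_zero_iff.2 fun _ _ => (w.pos' _).ne'

variable [MeasurableSpace G] [BorelSpace G] {Φ : YoungFunction} {μ : Measure G}
  [μ.IsMulRightInvariant]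

theorem ae_mul_right {p : G → Prop} (h : ∀ᵐ x ∂μ, p x) (b : G) : ∀ᵐ x ∂μ, p (x * b) :=
  (measurePreserving_mul_right μ b).quasiMeasurePreserving.ae h

theorem weightedTranslation_iterate_coeFn (a : G) (w : GroupWeight G) (n : ℕ)
    (f : OrliczSpace Φ μ) :
    (((weightedTranslation Φ μ a w)^[n] f : OrliczSpace Φ μ) : G →ₘ[μ] ℂ) =ᵐ[μ]
      fun x => (((weightPhiTilde a w n x)⁻¹ : ℝ) : ℂ) * (f : G →ₘ[μ] ℂ) (x * (a ^ n)⁻¹) := by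
  induction n with
  | zero => exact ae_of_all _ fun x => by simp [weightPhiTilde]
  | succ n ih =>
    rw [Function.iterate_succ_apply']
    filter_upwards [weightedTranslation_coeFn a w ((weightedTranslation Φ μ a w)^[n] f),
      ae_mul_right ih a⁻¹] with x h1 h2
    rw [h1, convDirac, h2, weightPhiTilde_succ, pow_succ, mul_inv_rev, mul_assoc]
    push_cast
    ring

theorem weightedTranslation_iterate_mul_pow (a : G) (w : GroupWeight G) (n : ℕ)
    (f : OrliczSpace Φ μ) :
    ∀ᵐ x ∂μ, (((weightedTranslation Φ μ a w)^[n] f : OrliczSpace Φ μ) : G →ₘ[μ] ℂ) (x * a ^ n) =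
      (weightPhi a w n x : ℂ) * (f : G →ₘ[μ] ℂ) x := by
  filter_upwards [ae_mul_right (weightedTranslation_iterate_coeFn a w n f) (a ^ n)] with x hx
  rw [hx, weightPhiTilde_mul_pow, inv_inv, mul_inv_cancel_right]

theorem orliczModular_mul_right (c : ℝ) (f : G → ℂ) (b : G) :
    orliczModular Φ μ c (fun x => f (x * b)) = orliczModular Φ μ c f :=
  lintegral_mul_right_eq_self (μ := μ) (fun x => ENNReal.ofReal (Φ (c * ‖f x‖))) b

variable (μ) in
/-- The weight products of length `n` are at most `δ` on a subset of `K` of deficiency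
at most `δ`. -/
def SmallWeights (a : G) (w : G → ℝ) (K : Set G) (δ : ℝ) (n : ℕ) : Prop :=
  ∃ E, MeasurableSet E ∧ E ⊆ K ∧ μ (K \ E) ≤ ENNReal.ofReal δ ∧
    ∀ᵐ x ∂μ, x ∈ E → weightPhi a w n x ≤ δ ∧ weightPhiTilde a w n x ≤ δ

/-- A vector near the indicator of `K`, with an iterate near this indicator, forces the weight
products to be small on most of `K`. -/
theorem smallWeights_of_norm_sub_lt {a : G} {w : GroupWeight G} {K : Set G}
    (hK : MeasurableSet K) {n : ℕ} (hn : ∀ x ∈ K, x * a ^ n ∉ K ∧ x * (a ^ n)⁻¹ ∉ K)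
    {χ f : OrliczSpace Φ μ} (hχ : (χ : G →ₘ[μ] ℂ) =ᵐ[μ] K.indicator 1) {δ ε : ℝ} (hδ : 0 < δ)
    (hδ1 : δ ≤ 1) (hε : 4 * (ENNReal.ofReal (Φ (ε⁻¹ * (δ / 2))))⁻¹ ≤ ENNReal.ofReal δ)
    (h1 : ‖f - χ‖ < ε) (h2 : ‖(weightedTranslation Φ μ a w)^[n] f - χ‖ < ε) :
    SmallWeights μ a w K δ n := by
  set h := (weightedTranslation Φ μ a w)^[n] f with hh
  have hbad : ∀ g : OrliczSpace Φ μ, ‖g - χ‖ < ε →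
      μ {x | δ / 2 ≤ ‖(g : G →ₘ[μ] ℂ) x - K.indicator 1 x‖} ≤
        (ENNReal.ofReal (Φ (ε⁻¹ * (δ / 2))))⁻¹ := by
    intro g hg
    refine le_trans (measure_mono_ae ?_)
      (OrliczSpace.measure_le_of_norm_lt (f := g - χ) (δ := δ / 2) (by positivity) hg)
    filter_upwards [OrliczSpace.coeFn_sub g χ, hχ] with x hx hx' hm
    change δ / 2 ≤ _
    rw [hx, hx']
    exact hm
  set η := (ENNReal.ofReal (Φ (ε⁻¹ * (δ / 2))))⁻¹
  set F := {x | δ / 2 ≤ ‖(f : G →ₘ[μ] ℂ) x - K.indicator 1 x‖} with hF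
  set H := {x | δ / 2 ≤ ‖(h : G →ₘ[μ] ℂ) x - K.indicator 1 x‖} with hH
  have hmeas : ∀ g : OrliczSpace Φ μ,
      MeasurableSet {x | δ / 2 ≤ ‖(g : G →ₘ[μ] ℂ) x - K.indicator 1 x‖} := fun g =>
    measurableSet_le measurable_const
      (((g : G →ₘ[μ] ℂ).measurable.sub (measurable_one.indicator hK)).norm)
  have hFm : MeasurableSet F := hmeas f
  have hHm : MeasurableSet H := hmeas h
  have hFη : μ F ≤ η := hbad f h1
  have hHη : μ H ≤ η := hbad h h2
  -- Discarded are the points where f or T^n f is far from the indicator at x, f is far from it at x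
  -- a^{-n}, or T^n f is far from it at x a^n. By invariance all four sets have measure at most η,
  -- hence the factor 4 in `hε`.
  refine ⟨K \ ((F ∪ H) ∪ ((fun x => x * (a ^ n)⁻¹) ⁻¹' F ∪ (fun x => x * a ^ n) ⁻¹' H)),
    hK.diff ((hFm.union hHm).union ((measurable_mul_const _ hFm).union
      (measurable_mul_const _ hHm))), Set.sdiff_subset, ?_, ?_⟩
  · refine le_trans ?_ hε
    calc _ ≤ μ ((F ∪ H) ∪ ((fun x => x * (a ^ n)⁻¹) ⁻¹' F ∪ (fun x => x * a ^ n) ⁻¹' H)) := by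
          refine measure_mono fun x hx => ?_
          by_contra hx'
          exact hx.2 ⟨hx.1, hx'⟩
      _ ≤ (μ F + μ H) + (μ ((fun x => x * (a ^ n)⁻¹) ⁻¹' F) +
            μ ((fun x => x * a ^ n) ⁻¹' H)) :=
          (measure_union_le _ _).trans (add_le_add (measure_union_le _ _) (measure_union_le _ _))
      _ ≤ (η + η) + (η + η) := by
          rw [measure_preimage_mul_right, measure_preimage_mul_right]
          gcongr
      _ = 4 * η := by ring
  · filter_upwards [weightedTranslation_iterate_coeFn a w n f,
      weightedTranslation_iterate_mul_pow a w n f] with x hx1 hx2 hxE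
    obtain ⟨hxK, hxE⟩ := hxE
    simp only [Set.mem_union, not_or, hF, hH, Set.mem_preimage, Set.mem_ofPred_eq, not_le,
      Set.indicator_of_mem hxK, Set.indicator_of_notMem (hn x hxK).1,
      Set.indicator_of_notMem (hn x hxK).2, sub_zero, Pi.one_apply] at hxE
    obtain ⟨⟨hf1, hh1⟩, hf2, hh2⟩ := hxE
    -- Here δ ≤ 1 enters. A value of size at least 1/2 at x against one below δ/2 at the translated
    -- point bounds each weight product by δ.
    have hlow : ∀ z : ℂ, ‖z - 1‖ < δ / 2 → 1 / 2 ≤ ‖z‖ := by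
      intro z hz
      have h3 := norm_sub_norm_le (1 : ℂ) z
      rw [norm_sub_rev, norm_one] at h3
      linarith
    constructor
    · have hp := weightPhi_pos a w.pos' n x
      rw [← hh] at hx2
      rw [hx2, norm_mul, Complex.norm_real, Real.norm_of_nonneg hp.le] at hh2
      nlinarith [hlow _ hf1]
    · have hp := weightPhiTilde_pos a w.pos' n x
      have h3 := hlow _ hh1
      rw [← hh] at hx1
      rw [hx1, norm_mul, Complex.norm_real, Real.norm_of_nonneg (inv_pos.2 hp).le,
        ← div_eq_inv_mul, le_div_iff₀ hp] at h3
      linarith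

/-- For an aperiodic element, if arbitrarily late transitions occur between open sets, then
the weight products are frequently small on most of every compact set. -/
theorem frequently_smallWeights [LocallyCompactSpace G] [T2Space G]
    [IsFiniteMeasureOnCompacts μ] {a : G}
    (ha : IsAperiodic a) {w : GroupWeight G}
    (hT : ∀ U V : Set (OrliczSpace Φ μ), IsOpen U → U.Nonempty → IsOpen V → V.Nonempty →
      ∃ᶠ n in atTop, ((weightedTranslation Φ μ a w)^[n] '' U ∩ V).Nonempty)
    {K : Set G} (hK : IsCompact K) {δ : ℝ} (hδ : 0 < δ) (hδ1 : δ ≤ 1) :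
    ∃ᶠ n in atTop, SmallWeights μ a w K δ n := by
  have hKm : MeasurableSet K := hK.measurableSet
  obtain ⟨ε, hε0, hε⟩ : ∃ ε > 0,
      4 * (ENNReal.ofReal (Φ (ε⁻¹ * (δ / 2))))⁻¹ ≤ ENNReal.ofReal δ := by
    -- With Φ(t) ≥ 4/δ, the choice ε = (δ/2)/t makes the argument of Φ in the Chebyshev bound equal
    -- to t.
    obtain ⟨t, ht, ht0⟩ := ((Φ.tendsto'.eventually_ge_atTop (4 * δ⁻¹)).and
      (eventually_gt_atTop 0)).exists
    refine ⟨(δ / 2) / t, by positivity, ?_⟩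
    have h1 : ((δ / 2) / t)⁻¹ * (δ / 2) = t := by field_simp
    rw [h1, ← ENNReal.ofReal_inv_of_pos (Φ.pos' t ht0),
      show (4 : ℝ≥0∞) = ENNReal.ofReal 4 by simp, ← ENNReal.ofReal_mul (by norm_num)]
    refine ENNReal.ofReal_le_ofReal ?_
    rw [← div_eq_mul_inv, div_le_iff₀ (Φ.pos' t ht0)]
    calc (4 : ℝ) = δ * (4 * δ⁻¹) := by field_simp
      _ ≤ δ * Φ t := by gcongr
  obtain ⟨χ, hχ⟩ : ∃ χ : OrliczSpace Φ μ, (χ : G →ₘ[μ] ℂ) =ᵐ[μ] K.indicator 1 :=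
    ⟨OrliczSpace.mk _ (measurable_one.indicator hKm).aestronglyMeasurable ⟨1, one_pos,
      (orliczModular_le_of_bounded (B := 1) zero_le_one hKm (ae_of_all _ fun x =>
        ⟨(norm_indicator_le_norm_self _ x).trans (by simp), fun hx => by simp [hx]⟩)).trans_lt
        (ENNReal.mul_lt_top ENNReal.ofReal_lt_top hK.measure_lt_top)⟩,
      OrliczSpace.coeFn_mk _ _ _⟩
  have hne : (Metric.ball χ ε).Nonempty := ⟨χ, Metric.mem_ball_self hε0⟩
  refine ((hT _ _ Metric.isOpen_ball hne Metric.isOpen_ball hne).and_eventually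
    (ha.eventually_mul_notMem hK)).mono ?_
  rintro n ⟨⟨_, ⟨f, hf, rfl⟩, hf'⟩, hn⟩
  exact smallWeights_of_norm_sub_lt hKm hn hχ hδ hδ1 hε (mem_ball_iff_norm.1 hf)
    (mem_ball_iff_norm.1 hf')

/-- If the weight products are small on most of a compact set `K`, then the translation carries
a vector near `f` to a vector near `g`, for all bounded `f`, `g` supported in `K`. -/
theorem exists_tendsto_iterate_of_smallWeights [T2Space G] [IsFiniteMeasureOnCompacts μ]
    {a : G} {w : GroupWeight G} {K : Set G} (hK : IsCompact K) {δ : ℕ → ℝ}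
    (hδ0 : ∀ k, 0 ≤ δ k) (hδ : Tendsto δ atTop (𝓝 0)) {n : ℕ → ℕ}
    (hn : ∀ k, SmallWeights μ a w K (δ k) (n k)) {f g : OrliczSpace Φ μ} {C : ℝ} (hC : 0 ≤ C)
    (hf : f ∈ OrliczSpace.boundedOn Φ μ K C) (hg : g ∈ OrliczSpace.boundedOn Φ μ K C) :
    ∃ u : ℕ → OrliczSpace Φ μ, Tendsto u atTop (𝓝 f) ∧
      Tendsto (fun k => (weightedTranslation Φ μ a w)^[n k] (u k)) atTop (𝓝 g) := by
  choose E hEm hEK hEδ hEw using hn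
  have hKm : MeasurableSet K := hK.measurableSet
  have htop : ∀ c, ENNReal.ofReal c * μ K < ∞ := fun c =>
    ENNReal.mul_lt_top ENNReal.ofReal_lt_top hK.measure_lt_top
  have hfm : StronglyMeasurable (f : G →ₘ[μ] ℂ) := AEEqFun.stronglyMeasurable _
  have hgm : StronglyMeasurable (g : G →ₘ[μ] ℂ) := AEEqFun.stronglyMeasurable _
  have hrestr : ∀ e ∈ OrliczSpace.boundedOn Φ μ K C, ∃ p : ℕ → OrliczSpace Φ μ,
      (∀ k, (p k : G →ₘ[μ] ℂ) =ᵐ[μ] (E k).indicator (e : G →ₘ[μ] ℂ)) ∧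
      Tendsto p atTop (𝓝 e) := by
    intro e he
    have hb : ∀ k, ∀ᵐ x ∂μ, ‖(E k).indicator (e : G →ₘ[μ] ℂ) x‖ ≤ C ∧
        (x ∉ K → (E k).indicator (e : G →ₘ[μ] ℂ) x = 0) := fun k => by
      filter_upwards [he] with x hx
      exact ⟨(norm_indicator_le_norm_self _ x).trans hx.1,
        fun hxK => Set.indicator_of_notMem (fun h => hxK (hEK k h)) _⟩
    refine ⟨fun k => OrliczSpace.mk _
      ((AEEqFun.stronglyMeasurable (e : G →ₘ[μ] ℂ)).indicator (hEm k)).aestronglyMeasurable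
      ⟨1, one_pos, (orliczModular_le_of_bounded zero_le_one hKm (hb k)).trans_lt (htop _)⟩,
      fun k => OrliczSpace.coeFn_mk _ _ _, OrliczSpace.tendsto_of_modular fun c hc => ?_⟩
    have h0 : Tendsto (fun k => ENNReal.ofReal (Φ (c * C)) * ENNReal.ofReal (δ k)) atTop
        (𝓝 0) := by
      simpa using ENNReal.Tendsto.const_mul (ENNReal.tendsto_ofReal hδ)
        (Or.inr ENNReal.ofReal_ne_top)
    refine tendsto_of_tendsto_of_tendsto_of_le_of_le tendsto_const_nhds h0
      (fun _ => zero_le) fun k => ?_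
    refine (orliczModular_le_of_bounded (B := C) hc.le (hKm.diff (hEm k)) ?_).trans
      (by gcongr; exact hEδ k)
    filter_upwards [he, OrliczSpace.coeFn_mk _
      ((AEEqFun.stronglyMeasurable (e : G →ₘ[μ] ℂ)).indicator (hEm k)).aestronglyMeasurable
      ⟨1, one_pos, (orliczModular_le_of_bounded (Φ := Φ) zero_le_one hKm (hb k)).trans_lt
        (htop _)⟩] with x hx hx'
    rw [hx']
    by_cases hxE : x ∈ E k
    · simp [hxE, hC]
    · simp only [Set.indicator_of_notMem hxE, zero_sub, norm_neg, neg_eq_zero, Set.mem_sdiff, hxE,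
        not_false_eq_true, and_true]
      exact hx
  have hlim : ∀ c > 0, Tendsto (fun k => ENNReal.ofReal (Φ (c * (C * δ k))) * μ K) atTop
      (𝓝 0) := by
    intro c hc
    have h1 : Tendsto (fun k => c * (C * δ k)) atTop (𝓝 0) := by
      simpa using (hδ.const_mul C).const_mul c
    have h2 : Tendsto (fun k => ENNReal.ofReal (Φ (c * (C * δ k)))) atTop (𝓝 0) := by
      have := ENNReal.tendsto_ofReal ((Φ.continuous'.tendsto 0).comp h1)
      simpa [Φ.zero'] using this
    simpa using ENNReal.Tendsto.mul_const h2 (Or.inr hK.measure_ne_top)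
  obtain ⟨p, hp, hpf⟩ := hrestr f hf
  obtain ⟨r, hr, hrg⟩ := hrestr g hg
  -- Translated by a^{n k}, the iterate becomes φ_{n k} times p k, which is bounded by C δ k and
  -- supported in K.
  have hTp : Tendsto (fun k => (weightedTranslation Φ μ a w)^[n k] (p k)) atTop (𝓝 0) := by
    refine OrliczSpace.tendsto_zero_of_modular fun c hc =>
      tendsto_of_tendsto_of_tendsto_of_le_of_le tendsto_const_nhds (hlim c hc)
        (fun _ => zero_le) fun k => ?_
    dsimp only
    rw [← orliczModular_mul_right c _ (a ^ n k),
      orliczModular_congr (weightedTranslation_iterate_mul_pow a w (n k) (p k))]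
    refine orliczModular_le_of_bounded hc.le hKm ?_
    filter_upwards [hf, hp k, hEw k] with x hx1 hx2 hx3
    rw [hx2]
    by_cases hxE : x ∈ E k
    · rw [Set.indicator_of_mem hxE, norm_mul, Complex.norm_real,
        Real.norm_of_nonneg (weightPhi_pos a w.pos' _ x).le, mul_comm]
      exact ⟨mul_le_mul hx1.1 (hx3 hxE).1 (weightPhi_pos a w.pos' _ x).le hC,
        fun h => absurd (hEK k hxE) h⟩
    · have hδk := hδ0 k
      simp only [Set.indicator_of_notMem hxE, mul_zero, norm_zero, implies_true, and_true]
      positivity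
  -- The translate x ↦ q₀ k (x a^{n k}) is the exact preimage of g cut to E k under the n k-th
  -- iterate, and the factor φ̃ makes it small.
  let q₀ : ℕ → G → ℂ := fun k =>
    (E k).indicator fun x => (weightPhiTilde a w (n k) x : ℂ) * (g : G →ₘ[μ] ℂ) x
  have hq₀m : ∀ k, StronglyMeasurable (q₀ k) := fun k =>
    ((Complex.continuous_ofReal.comp
      (continuous_weightPhiTilde a w (n k))).measurable.stronglyMeasurable.mul hgm).indicator
      (hEm k)
  have hq₀ : ∀ k, ∀ c > 0, orliczModular Φ μ c (fun x => q₀ k (x * a ^ n k)) ≤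
      ENNReal.ofReal (Φ (c * (C * δ k))) * μ K := by
    intro k c hc
    rw [orliczModular_mul_right]
    refine orliczModular_le_of_bounded hc.le hKm ?_
    filter_upwards [hg, hEw k] with x hx1 hx3
    by_cases hxE : x ∈ E k
    · simp only [q₀]
      rw [Set.indicator_of_mem hxE, norm_mul, Complex.norm_real,
        Real.norm_of_nonneg (weightPhiTilde_pos a w.pos' _ x).le, mul_comm]
      exact ⟨mul_le_mul hx1.1 (hx3 hxE).2 (weightPhiTilde_pos a w.pos' _ x).le hC,
        fun h => absurd (hEK k hxE) h⟩
    · have hδk := hδ0 k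
      simp only [q₀, Set.indicator_of_notMem hxE, norm_zero, implies_true, and_true]
      positivity
  have hmk : ∀ k, ∃ q : OrliczSpace Φ μ,
      (q : G →ₘ[μ] ℂ) =ᵐ[μ] fun x => q₀ k (x * a ^ n k) := fun k =>
    ⟨OrliczSpace.mk _ ((hq₀m k).comp_measurable (measurable_mul_const _)).aestronglyMeasurable
      ⟨1, one_pos, (hq₀ k 1 one_pos).trans_lt (htop _)⟩, OrliczSpace.coeFn_mk _ _ _⟩
  choose q hq using hmk
  have hq0 : Tendsto q atTop (𝓝 0) := by
    refine OrliczSpace.tendsto_zero_of_modular fun c hc =>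
      tendsto_of_tendsto_of_tendsto_of_le_of_le tendsto_const_nhds (hlim c hc)
        (fun _ => zero_le) fun k => ?_
    dsimp only
    rw [orliczModular_congr (hq k)]
    exact hq₀ k c hc
  have hTq : ∀ k, (weightedTranslation Φ μ a w)^[n k] (q k) = r k := fun k =>
    OrliczSpace.ext_ae <| by
      filter_upwards [weightedTranslation_iterate_coeFn a w (n k) (q k),
        ae_mul_right (hq k) (a ^ n k)⁻¹, hr k] with x h1 h2 h3
      rw [h1, h2, h3, inv_mul_cancel_right]
      simp only [q₀]
      by_cases hxE : x ∈ E k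
      · have hne : (weightPhiTilde a w (n k) x : ℂ) ≠ 0 :=
          Complex.ofReal_ne_zero.2 (weightPhiTilde_pos a w.pos' _ x).ne'
        rw [Set.indicator_of_mem hxE, Set.indicator_of_mem hxE, Complex.ofReal_inv,
          inv_mul_cancel_left₀ hne]
      · simp [hxE]
  refine ⟨fun k => p k + q k, by simpa using hpf.add hq0, ?_⟩
  have heq : ∀ k, (weightedTranslation Φ μ a w)^[n k] (p k + q k) =
      (weightedTranslation Φ μ a w)^[n k] (p k) + r k := fun k => by
    rw [iterate_map_add, hTq]
  simpa [heq] using hTp.add hrg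

/-- Truncation replaces the two target vectors by bounded ones supported in a common compact set, to
which `exists_tendsto_iterate_of_smallWeights` applies. -/
theorem isTopologicallyTransitive_of_smallWeights [T2Space G] [LocallyCompactSpace G]
    [SecondCountableTopology G] [IsFiniteMeasureOnCompacts μ] [μ.IsOpenPosMeasure]
    {a : G} {w : GroupWeight G} {M : ℝ} (hM : ∀ t > 0, Φ (2 * t) ≤ M * Φ t)
    (h : ∀ K : Set G, IsCompact K → 0 < μ K → ∀ δ > 0, ∃ n, SmallWeights μ a w K δ n) :
    IsTopologicallyTransitive (weightedTranslation Φ μ a w) := by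
  rintro U V hU ⟨f, hf⟩ hV ⟨g, hg⟩
  let S := compactCovering G
  have hSm : ∀ n, MeasurableSet (S n) := fun n => (isCompact_compactCovering G n).measurableSet
  obtain ⟨u, hu, huf⟩ := OrliczSpace.exists_tendsto_boundedOn hM hSm
    (compactCovering_subset G) (iUnion_compactCovering G) f
  obtain ⟨v, hv, hvg⟩ := OrliczSpace.exists_tendsto_boundedOn hM hSm
    (compactCovering_subset G) (iUnion_compactCovering G) g
  obtain ⟨m, hmU, hmV⟩ := ((huf.eventually (hU.mem_nhds hf)).and
    (hvg.eventually (hV.mem_nhds hg))).exists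
  -- Adjoining a compact neighbourhood of 1 gives the compact set positive measure, as `h` demands.
  obtain ⟨K₀, hK₀c, hK₀⟩ := exists_compact_mem_nhds (1 : G)
  have hKc : IsCompact (S m ∪ K₀) := (isCompact_compactCovering G m).union hK₀c
  have hKpos : 0 < μ (S m ∪ K₀) :=
    (μ.measure_pos_of_mem_nhds hK₀).trans_le (measure_mono Set.subset_union_right)
  have hmono : OrliczSpace.boundedOn Φ μ (S m) m ⊆ OrliczSpace.boundedOn Φ μ (S m ∪ K₀) m := by
    intro e he
    have he' : ∀ᵐ x ∂μ, ‖(e : G →ₘ[μ] ℂ) x‖ ≤ m ∧ (x ∉ S m → (e : G →ₘ[μ] ℂ) x = 0) := he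
    change ∀ᵐ x ∂μ, _
    filter_upwards [he'] with x hx
    exact ⟨hx.1, fun h => hx.2 fun h' => h (Or.inl h')⟩
  choose n hn using fun k : ℕ => h _ hKc hKpos (1 / ((k : ℝ) + 1)) (by positivity)
  obtain ⟨z, hz, hTz⟩ := exists_tendsto_iterate_of_smallWeights hKc
    (fun k => by positivity) tendsto_one_div_add_atTop_nhds_zero_nat hn (Nat.cast_nonneg m)
    (hmono (hu m)) (hmono (hv m))
  obtain ⟨k, hkU, hkV⟩ := ((hz.eventually (hU.mem_nhds hmU)).and
    (hTz.eventually (hV.mem_nhds hmV))).exists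
  exact ⟨n k, _, ⟨z k, hkU, rfl⟩, hkV⟩

end WeightedTranslation

/-! ### Passage between `SmallWeights` and the sequential condition (iii). -/

section SmallWeights

variable {G : Type*} [Group G] [TopologicalSpace G] [MeasurableSpace G] {μ : Measure G}

theorem smallWeights_of_tendsto {a : G} {w : GroupWeight G} {K : Set G} (hK : μ K ≠ ∞)
    {E : ℕ → Set G} {n : ℕ → ℕ} (hE : ∀ k, MeasurableSet (E k) ∧ E k ⊆ K)
    (hμ : Tendsto (fun k => μ (E k)) atTop (𝓝 (μ K)))
    (h1 : Tendsto (fun k => eLpNorm (weightPhi a w (n k)) ∞ (μ.restrict (E k))) atTop (𝓝 0))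
    (h2 : Tendsto (fun k => eLpNorm (weightPhiTilde a w (n k)) ∞ (μ.restrict (E k)))
      atTop (𝓝 0)) {δ : ℝ} (hδ : 0 < δ) : ∃ n, SmallWeights μ a w K δ n := by
  have hδ' : 0 < ENNReal.ofReal δ := ENNReal.ofReal_pos.2 hδ
  have h0 : Tendsto (fun k => μ (K \ E k)) atTop (𝓝 0) := by
    have := ENNReal.Tendsto.sub (tendsto_const_nhds (x := μ K)) hμ (Or.inl hK)
    rw [tsub_self] at this
    refine this.congr fun k => ?_
    rw [measure_sdiff (hE k).2 (hE k).1.nullMeasurableSet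
      (measure_ne_top_of_subset (hE k).2 hK)]
  obtain ⟨k, hk0, hk1, hk2⟩ := ((h0.eventually (ge_mem_nhds hδ')).and
    ((h1.eventually (ge_mem_nhds hδ')).and (h2.eventually (ge_mem_nhds hδ')))).exists
  have hbd : ∀ φ : G → ℝ, eLpNorm φ ∞ (μ.restrict (E k)) ≤ ENNReal.ofReal δ →
      ∀ᵐ x ∂μ, x ∈ E k → φ x ≤ δ := by
    intro φ hφ
    rw [eLpNorm_exponent_top] at hφ
    rw [← ae_restrict_iff' (hE k).1]
    filter_upwards [ae_le_eLpNormEssSup (f := φ) (μ := μ.restrict (E k))] with x hx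
    have h3 := hx.trans hφ
    rw [← ofReal_norm, ENNReal.ofReal_le_ofReal_iff hδ.le] at h3
    exact (le_abs_self _).trans h3
  refine ⟨n k, E k, (hE k).1, (hE k).2, hk0, ?_⟩
  filter_upwards [hbd _ hk1, hbd _ hk2] with x hx1 hx2 hx using ⟨hx1 hx, hx2 hx⟩

/-- Take δ = 1/(k+1) at stage k; since good n occur arbitrarily late, they can be chosen strictly
increasing. -/
theorem exists_tendsto_of_frequently_smallWeights {a : G} {w : GroupWeight G} {K : Set G}
    (hK : μ K ≠ ∞)
    (h : ∀ δ : ℝ, 0 < δ → δ ≤ 1 → ∃ᶠ n in atTop, SmallWeights μ a w K δ n) :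
    ∃ (E : ℕ → Set G) (n : ℕ → ℕ), (∀ k, MeasurableSet (E k) ∧ E k ⊆ K) ∧
      Tendsto (fun k => μ (E k)) atTop (𝓝 (μ K)) ∧ StrictMono n ∧
      Tendsto (fun k => eLpNorm (weightPhi a w (n k)) ∞ (μ.restrict (E k))) atTop (𝓝 0) ∧
      Tendsto (fun k => eLpNorm (weightPhiTilde a w (n k)) ∞ (μ.restrict (E k)))
        atTop (𝓝 0) := by
  obtain ⟨n, hnm, hn⟩ := extraction_forall_of_frequently fun k : ℕ =>
    h (1 / ((k : ℝ) + 1)) (by positivity)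
      ((div_le_one (by positivity)).2 (by linarith [Nat.cast_nonneg (α := ℝ) k]))
  choose E hEm hEK hEδ hEw using hn
  have hlim : Tendsto (fun k : ℕ => ENNReal.ofReal (1 / ((k : ℝ) + 1))) atTop (𝓝 0) := by
    simpa only [ENNReal.ofReal_zero] using
      ENNReal.tendsto_ofReal (tendsto_one_div_add_atTop_nhds_zero_nat (𝕜 := ℝ))
  have hsmall : ∀ φ : ℕ → G → ℝ, (∀ k x, 0 < φ k x) →
      (∀ k, ∀ᵐ x ∂μ, x ∈ E k → φ k x ≤ 1 / ((k : ℝ) + 1)) →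
      Tendsto (fun k => eLpNorm (φ k) ∞ (μ.restrict (E k))) atTop (𝓝 0) := by
    intro φ hφ hle
    refine tendsto_of_tendsto_of_tendsto_of_le_of_le tendsto_const_nhds hlim
      (fun _ => zero_le) fun k => ?_
    dsimp only
    rw [eLpNorm_exponent_top]
    refine eLpNormEssSup_le_of_ae_bound ?_
    rw [ae_restrict_iff' (hEm k)]
    filter_upwards [hle k] with x hx hxE
    rw [Real.norm_of_nonneg (hφ k x).le]
    exact hx hxE
  refine ⟨E, n, fun k => ⟨hEm k, hEK k⟩, ?_, hnm,
    hsmall _ (fun k => weightPhi_pos a w.pos' (n k)) fun k => ?_,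
    hsmall _ (fun k => weightPhiTilde_pos a w.pos' (n k)) fun k => ?_⟩
  · have hsub : Tendsto (fun k : ℕ => μ K - ENNReal.ofReal (1 / ((k : ℝ) + 1))) atTop
        (𝓝 (μ K)) := by
      simpa only [tsub_zero] using
        ENNReal.Tendsto.sub (tendsto_const_nhds (x := μ K)) hlim (Or.inl hK)
    refine tendsto_of_tendsto_of_tendsto_of_le_of_le hsub tendsto_const_nhds (fun k => ?_)
      fun k => measure_mono (hEK k)
    refine tsub_le_iff_right.2 ?_
    calc μ K = μ (E k ∪ K \ E k) := by rw [Set.union_sdiff_cancel (hEK k)]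
      _ ≤ μ (E k) + μ (K \ E k) := measure_union_le _ _
      _ ≤ _ := by gcongr; exact hEδ k
  · filter_upwards [hEw k] with x hx hxE using (hx hxE).1
  · filter_upwards [hEw k] with x hx hxE using (hx hxE).2

end SmallWeights

end

/-! ### The equivalence. -/

theorem corollary2p5 {G : Type*} [Group G] [TopologicalSpace G] [IsTopologicalGroup G]
    [T2Space G] [LocallyCompactSpace G] [SecondCountableTopology G]
    [MeasurableSpace G] [BorelSpace G]
    (μ : Measure G) [μ.IsMulRightInvariant] [IsFiniteMeasureOnCompacts μ] [μ.IsOpenPosMeasure]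
    (Φ : YoungFunction) (hΦ : Φ.IsDelta2Regular G)
    (w : GroupWeight G) (hw : MemLp (fun x => (w x)⁻¹) ∞ μ)
    (a : G) (ha : IsAperiodic a) :
    List.TFAE
      [ IsTopologicallyTransitive (weightedTranslation Φ μ a w),
        IsHypercyclic (weightedTranslation Φ μ a w),
        ∀ K : Set G, IsCompact K → 0 < μ K →
          ∃ (E : ℕ → Set G) (n : ℕ → ℕ),
            (∀ k, MeasurableSet (E k) ∧ E k ⊆ K) ∧
            Tendsto (fun k => μ (E k)) atTop (𝓝 (μ K)) ∧
            StrictMono n ∧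
            Tendsto (fun k => eLpNorm (weightPhi a w (n k)) ∞ (μ.restrict (E k)))
              atTop (𝓝 0) ∧
            Tendsto (fun k => eLpNorm (weightPhiTilde a w (n k)) ∞ (μ.restrict (E k)))
              atTop (𝓝 0) ] := by
  -- A compact group has no aperiodic element, so the doubling condition holds for all t > 0.
  have := ha.noncompactSpace
  obtain ⟨M, -, hM⟩ := hΦ.2 this
  have : TopologicalSpace.SeparableSpace (OrliczSpace Φ μ) := OrliczSpace.separableSpace hM
  have : SecondCountableTopology (OrliczSpace Φ μ) :=
    UniformSpace.secondCountable_of_separable _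
  tfae_have 1 → 2 := fun h => h.isHypercyclic (weightedTranslation Φ μ a w).continuous
  tfae_have 2 → 3 := by
    intro h K hK _
    refine exists_tendsto_of_frequently_smallWeights hK.measure_ne_top fun δ hδ hδ1 =>
      frequently_smallWeights ha (Φ := Φ) ?_ hK hδ hδ1
    intro U V hU hUne hV hVne
    -- The zero space consists of an isolated point and is treated apart; a nontrivial normed space
    -- has no isolated points.
    rcases subsingleton_or_nontrivial (OrliczSpace Φ μ) with hs | hs
    · obtain ⟨u, hu⟩ := hUne
      obtain ⟨v, hv⟩ := hVne
      exact Frequently.of_forall fun n => ⟨v, ⟨u, hu, Subsingleton.elim _ _⟩, hv⟩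
    · have : ∀ x : OrliczSpace Φ μ, (𝓝[≠] x).NeBot :=
        Module.punctured_nhds_neBot ℂ (OrliczSpace Φ μ)
      exact h.frequently hU hUne hV hVne
  tfae_have 3 → 1 := by
    intro h
    refine isTopologicallyTransitive_of_smallWeights hM fun K hK hKpos δ hδ => ?_
    obtain ⟨E, n, hE, hμ, -, h1, h2⟩ := h K hK hKpos
    exact smallWeights_of_tendsto hK.measure_ne_top hE hμ h1 h2 hδ
  tfae_finish
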